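/- Let $m\ge 0$, $n\ge 1$ be integers and $p\ge 1$ a real number. Let $W\in C^1(\mathbb{R}^{m\times n})$ be positively $p$-homogeneous, i.e. $W(\lambda F)=\lambda^pW(F)$ for all $\lambda>0$ and all $F\in\mathbb{R}^{m\times n}$, and suppose that $W(a\otimes\nu)\ge 0$ for all $a\in\mathbb{R}^m$, $\nu\in\mathbb{R}^n$, where $(a\otimes\nu)_{ij}=a_i\nu_j$. Let $\Omega\subset\mathbb{R}^n$ be a bounded open set that is star-shaped with respect to some point. Let $\Phi\in C^1(\mathbb{R}^m)$ satisfy $\Phi(0)=0$ and $$np\,\Phi(\eta)\le (n-p)\,\Phi_y(\eta)\cdot\eta\qquad\text{for all }\eta\in\mathbb{R}^m,$$ where $\Phi_y$ is the gradient of $\Phi$. Suppose that $\{0\}$ is the connected component containing $0$ of the set $$Z=\{\eta\in\mathbb{R}^m:\ np\,\Phi(\eta)=(n-p)\,\Phi_y(\eta)\cdot\eta\}.$$ Then $y\equiv 0$ is the one and only solution $y\in C^2(\overline\Omega;\mathbb{R}^m)$ of the boundary value problem $$\operatorname{div}W_F(\nabla y)+\Phi_y(y)=0\ \text{ in }\Omega,\qquad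 y=0\ \text{ on }\partial\Omega.$$ Here $(\nabla y)_{ij}=\partial y_i/\partial x_j$, $(W_F)_{ij}=\partial W/\partial F_{ij}$, the divergence is taken row by row, and the equation is understood in the sense of distributions in $\Omega$ (since $W$ is only $C^1$, the field $W_F(\nabla y)$ is in general merely continuous). -/

import Mathlib

open MeasureTheory
open scoped ContDiff

/- Any norm on the finite-dimensional space of matrices gives the same `C¹` functions and the same
derivatives; the entrywise sup norm is used. -/
attribute [local instance] Matrix.normedAddCommGroup Matrix.normedSpace

noncomputable section

namespace Pohozaev

/-- The gradient `W_F(F)` of a function of matrices: entry `(i, j)` is `∂W/∂F_{ij}`. -/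
def matrixGradient {m n : ℕ} (W : Matrix (Fin m) (Fin n) ℝ → ℝ) (F : Matrix (Fin m) (Fin n) ℝ) :
    Matrix (Fin m) (Fin n) ℝ :=
  Matrix.of fun i j => fderiv ℝ W F (Matrix.single i j 1)

/-- The Jacobian matrix `∇y(x)`: entry `(i, j)` is `∂y_i/∂x_j`. -/
def jacobian {m n : ℕ} (y : EuclideanSpace ℝ (Fin n) → EuclideanSpace ℝ (Fin m))
    (x : EuclideanSpace ℝ (Fin n)) : Matrix (Fin m) (Fin n) ℝ :=
  Matrix.of fun i j => fderiv ℝ y x (EuclideanSpace.single j 1) i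

/-- `div V = f` in `Ω` in the sense of distributions, for a locally integrable vector field `V` and
a locally integrable function `f`. -/
def HasDistribDivergence {n : ℕ} (Ω : Set (EuclideanSpace ℝ (Fin n)))
    (V : EuclideanSpace ℝ (Fin n) → Fin n → ℝ) (f : EuclideanSpace ℝ (Fin n) → ℝ) : Prop :=
  LocallyIntegrableOn V Ω volume ∧ LocallyIntegrableOn f Ω volume ∧
    ∀ φ : EuclideanSpace ℝ (Fin n) → ℝ, ContDiff ℝ ∞ φ → HasCompactSupport φ → tsupport φ ⊆ Ω →
      ∫ x in Ω, ∑ j, V x j * fderiv ℝ φ x (EuclideanSpace.single j 1) = -∫ x in Ω, f x * φ x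

/-- `y ∈ C²(closure Ω; ℝᵐ)` solves `div W_F(∇y) + Φ_y(y) = 0` in `Ω`, `y = 0` on `∂Ω`. As `W` is
only `C¹`, the field `W_F(∇y)` is in general merely continuous, and its row-wise divergence is
taken in the sense of distributions. -/
structure IsSolution {m n : ℕ} (W : Matrix (Fin m) (Fin n) ℝ → ℝ)
    (Φ : EuclideanSpace ℝ (Fin m) → ℝ) (Ω : Set (EuclideanSpace ℝ (Fin n)))
    (y : EuclideanSpace ℝ (Fin n) → EuclideanSpace ℝ (Fin m)) : Prop where
  contDiffOn : ContDiffOn ℝ 2 y (closure Ω)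
  equation : ∀ i, HasDistribDivergence Ω (fun x => matrixGradient W (jacobian y x) i)
    (fun x => -(gradient Φ (y x) i))
  boundary : ∀ x ∈ frontier Ω, y x = 0

end Pohozaev

end

/-! The argument is Pohozaev's identity. Formally, one tests the equation with `y` and with `(∇y)x`.
Since `y = 0` on the boundary, `∇y = a ⊗ ν` there, so the boundary term is `(p - 1) ∫ W(a ⊗ ν) x·ν`,
which is nonnegative on a domain star-shaped about the origin. This leaves `(n - p) ∫ Φ_y(y)·y ≤ np
∫ Φ(y)`. The pointwise hypothesis gives the reverse inequality for the integrands, hence equality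
everywhere and `y(x) ∈ Z`. The extension of `y` by zero is continuous on a connected space and takes
the value `0`, so its range lies in the component `{0}`.

The boundary has no normal or surface measure here, so the field `(∇y)x` is replaced by a
difference: the equation is tested with `x ↦ y(tx)`, extended by zero, for `t > 1`, and compared
with `y` to first order as `t ↓ 1` (`pohozaev_inequality`). Such functions are admissible by
truncation near the value zero (`WeakForm.of_contDiffOn`). The boundary term becomes `(p - 1) ∫
W(∇y)` over the layer of points `x ∈ Ω` with `tx ∉ Ω`, and it suffices that this is at least `-o(t -
1)` (`eventually_le_setIntegral_outerLayer`).

That bound rests on a dimension count. Boundary points where the derivative of `y` has rank at least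
two form a set of Hausdorff dimension at most `n - 2`, so the cone over them is null
(`measure_zero_cone_of_two_le_finrank_range`). Along almost every ray the limiting gradient
therefore has rank at most one, where `W ≥ 0`. A geometric series in the dilation factor replaces
polar coordinates (`setLIntegral_outerLayer_eq`).

Conversely, dividing the hypothesis on `Φ` along a ray by its length forces `Φ_y(0) = 0`, so zero is
a solution. -/

namespace Pohozaev

open Filter Topology Set Module
open scoped NNReal ENNReal

/-! ### Hausdorff dimension of zero sets -/

section Dimension

variable {E F : Type*} [NormedAddCommGroup E] [NormedSpace ℝ E] [FiniteDimensional ℝ E]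
  [NormedAddCommGroup F] [NormedSpace ℝ F]

/-- Coordinates on the kernel, extended to the whole space, detect exactly what `A` misses. -/
theorem exists_injective_prod {d : ℕ} (A : E →L[ℝ] F)
    (hA : finrank ℝ (LinearMap.ker (A : E →ₗ[ℝ] F)) ≤ d) :
    ∃ P : E →L[ℝ] (Fin d → ℝ), Function.Injective (A.prod P) := by
  obtain ⟨g, hg⟩ : ∃ g : LinearMap.ker (A : E →ₗ[ℝ] F) →ₗ[ℝ] (Fin d → ℝ),
      Function.Injective g := by
    exact finrank_le_iff_exists_linearMap.1 (by simpa using hA)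
  obtain ⟨P, hP⟩ := LinearMap.exists_extend g
  refine ⟨LinearMap.toContinuousLinearMap P, ?_⟩
  rw [injective_iff_map_eq_zero]
  intro v hv
  have h1 : A v = 0 := congrArg Prod.fst hv
  have h2 : P v = 0 := congrArg Prod.snd hv
  have h3 : g ⟨v, h1⟩ = 0 := by rw [← h2, ← hP]; rfl
  have := (injective_iff_map_eq_zero g).1 hg _ h3
  exact congrArg Subtype.val this

theorem dimH_le_of_norm_sub_le {X : Type*} [NormedAddCommGroup X] [NormedSpace ℝ X] {d : ℕ}
    (P : X →L[ℝ] (Fin d → ℝ)) (K : ℝ≥0) (s : Set X)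
    (h : ∀ x ∈ s, ∀ z ∈ s, ‖x - z‖ ≤ K * ‖P (x - z)‖) : dimH s ≤ d := by
  have h1 : AntilipschitzWith K (fun x : s => P x) := by
    refine AntilipschitzWith.of_le_mul_dist fun x z => ?_
    have := h x x.2 z z.2
    rwa [map_sub, ← dist_eq_norm, ← dist_eq_norm] at this
  have h2 := h1.le_dimH_image univ
  have h3 : dimH s = dimH (univ : Set s) := by
    rw [← (isometry_subtype_coe (s := s)).dimH_image]
    simp
  rw [h3]
  refine h2.trans ((dimH_mono (subset_univ _)).trans ?_)
  simp [Real.dimH_univ_pi_fin]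

/-- A set on which a function vanishes while its derivative has kernel of dimension at most `d` has
Hausdorff dimension at most `d`. -/
theorem dimH_le_of_finrank_ker_le {d : ℕ} {f : E → F} {f' : E → E →L[ℝ] F} {s : Set E}
    (hf : ∀ x ∈ s, f x = 0) (hf' : ∀ x ∈ s, HasFDerivWithinAt f (f' x) s x)
    (hd : ∀ x ∈ s, finrank ℝ (LinearMap.ker (f' x : E →ₗ[ℝ] F)) ≤ d) : dimH s ≤ d := by
  obtain ⟨Q, hQc, hQd⟩ := TopologicalSpace.exists_countable_dense (E →L[ℝ] (Fin d → ℝ))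
  obtain ⟨D, hDc, hDd⟩ := TopologicalSpace.exists_countable_dense E
  have := hQc.to_subtype
  have := hDc.to_subtype
  -- Each piece fixes a map `P` complementing `f' x`, a quantitative injectivity constant `k + 1`, a
  -- scale `1 / (l + 1)` below which the Taylor remainder is small, and a ball of diameter at most
  -- that scale. For two points of a piece `f` vanishes at both, so `f' x (z - x)` is only
  -- remainder. The factor `1 / (2(k + 1))` lets it be absorbed, and `P` is antilipschitz on the
  -- piece.
  let S : Q × ℕ × ℕ × D → Set E := fun i => {x | x ∈ s ∧
    (∀ v, ‖v‖ ≤ (i.2.1 + 1 : ℝ) * (‖f' x v‖ + ‖(i.1 : E →L[ℝ] (Fin d → ℝ)) v‖)) ∧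
    (∀ z ∈ s, ‖z - x‖ < 1 / (i.2.2.1 + 1 : ℝ) →
      ‖f z - f x - f' x (z - x)‖ ≤ 1 / (2 * (i.2.1 + 1 : ℝ)) * ‖z - x‖) ∧
    ‖x - i.2.2.2‖ < 1 / (2 * (i.2.2.1 + 1 : ℝ))}
  have hcov : s ⊆ ⋃ i, S i := by
    intro x hx
    obtain ⟨P, hPQ, hP⟩ : ∃ P ∈ Q, Function.Injective ((f' x).prod P) := by
      obtain ⟨P₀, hP₀⟩ := exists_injective_prod (f' x) (hd x hx)
      have hopen : IsOpen {P : E →L[ℝ] (Fin d → ℝ) | Function.Injective ((f' x).prod P)} := by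
        refine (ContinuousLinearMap.isOpen_injective (𝕜 := ℝ) (E := E)
          (F := F × (Fin d → ℝ))).preimage (f := fun P => (f' x).prod P) ?_
        exact (ContinuousLinearMap.prodₗᵢ (𝕜 := ℝ) (E := E) (F := F)
          (G := Fin d → ℝ) ℝ).continuous.comp (Continuous.prodMk_right (f' x))
      obtain ⟨P, hP, hPQ⟩ := hQd.inter_open_nonempty _ hopen ⟨P₀, hP₀⟩
      exact ⟨P, hPQ, hP⟩
    obtain ⟨K, -, hK⟩ := (LinearMap.injective_iff_antilipschitz
      (((f' x).prod P : E →L[ℝ] F × (Fin d → ℝ)) : E →ₗ[ℝ] F × (Fin d → ℝ))).1 hP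
    obtain ⟨k, hk⟩ := exists_nat_ge (K : ℝ)
    have hε : (0 : ℝ) < 1 / (2 * (k + 1 : ℝ)) := by positivity
    have h1 := (hf' x hx).isLittleO.def hε
    obtain ⟨δ, hδ, hδ'⟩ := Metric.mem_nhdsWithin_iff.1 h1
    obtain ⟨l, hl⟩ := exists_nat_one_div_lt hδ
    obtain ⟨c, hc, hcx⟩ := hDd.exists_dist_lt x (show (0 : ℝ) < 1 / (2 * (l + 1 : ℝ)) by positivity)
    refine mem_iUnion.2 ⟨(⟨P, hPQ⟩, k, l, ⟨c, hc⟩), hx, ?_, ?_, ?_⟩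
    · intro v
      have h2 : ‖v‖ ≤ K * ‖((f' x).prod P) v‖ := by
        simpa [dist_eq_norm] using hK.le_mul_dist v 0
      refine h2.trans ?_
      have h3 : ‖((f' x).prod P) v‖ ≤ ‖f' x v‖ + ‖P v‖ := by
        rw [ContinuousLinearMap.prod_apply, Prod.norm_def]
        exact max_le_add_of_nonneg (norm_nonneg _) (norm_nonneg _)
      exact mul_le_mul (by dsimp only; linarith) h3 (norm_nonneg _) (by positivity)
    · intro z hz hzx
      refine hδ' ⟨?_, hz⟩
      rw [Metric.mem_ball, dist_eq_norm]
      exact hzx.trans hl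
    · rw [dist_eq_norm] at hcx
      exact hcx
  refine (dimH_mono hcov).trans ?_
  rw [dimH_iUnion]
  refine iSup_le fun i => ?_
  obtain ⟨P, k, l, c⟩ := i
  refine dimH_le_of_norm_sub_le (P : E →L[ℝ] (Fin d → ℝ)) (2 * (k + 1)) _ ?_
  rintro z ⟨hz, -, -, hz4⟩ x ⟨hx, hx2, hx3, hx4⟩
  dsimp only at hx2 hx3 hx4 hz4
  have h1 : ‖z - x‖ < 1 / (l + 1 : ℝ) := by
    have : z - x = (z - c) - (x - c) := by abel
    rw [this]
    refine (norm_sub_le _ _).trans_lt ((add_lt_add hz4 hx4).trans_le (le_of_eq ?_))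
    field_simp
    norm_num
  have h2 := hx3 z hz h1
  rw [hf z hz, hf x hx, sub_zero, zero_sub, norm_neg] at h2
  have h3 := hx2 (z - x)
  have h4 : (k + 1 : ℝ) * ‖f' x (z - x)‖ ≤ ‖z - x‖ / 2 := by
    refine (mul_le_mul_of_nonneg_left h2 (by positivity)).trans (le_of_eq ?_)
    field_simp
  push_cast
  linarith

theorem measure_zero_of_dimH_lt_finrank [MeasurableSpace E] [BorelSpace E] (μ : Measure E)
    [μ.IsAddHaarMeasure] {s : Set E} (h : dimH s < finrank ℝ E) : μ s = 0 := by
  have := isAddHaarMeasure_hausdorffMeasure (E := E)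
  refine measure_zero_of_dimH_lt (d := finrank ℝ E) ?_ (by simpa using h)
  rw [NNReal.coe_natCast]
  exact Measure.absolutelyContinuous_isAddHaarMeasure _ _

theorem finrank_ker_add_one_le_of_ne_zero {A : E →L[ℝ] F} (hA : A ≠ 0) :
    finrank ℝ (LinearMap.ker (A : E →ₗ[ℝ] F)) + 1 ≤ finrank ℝ E := by
  refine Submodule.finrank_lt fun h => hA ?_
  ext v
  have : v ∈ LinearMap.ker (A : E →ₗ[ℝ] F) := h ▸ Submodule.mem_top
  exact this

/-- The gradient of a function vanishes almost everywhere on its zero set. -/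
theorem measure_zero_setOf_eq_zero_fderiv_ne_zero [MeasurableSpace E] [BorelSpace E]
    (μ : Measure E) [μ.IsAddHaarMeasure] {f : E → F} {s : Set E}
    (hf : ∀ x ∈ s, DifferentiableAt ℝ f x) :
    μ {x | x ∈ s ∧ f x = 0 ∧ fderiv ℝ f x ≠ 0} = 0 := by
  -- In dimension zero the truncated `finrank ℝ E - 1` is not smaller than `finrank ℝ E`, so that
  -- case is separate.
  rcases Nat.eq_zero_or_pos (finrank ℝ E) with h0 | h0
  · convert measure_empty (μ := μ)
    ext x
    simp only [mem_ofPred_eq, mem_empty_iff_false, iff_false, not_and, not_not]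
    intro _ _
    by_contra h
    have := finrank_ker_add_one_le_of_ne_zero h
    omega
  refine measure_zero_of_dimH_lt_finrank μ ?_
  have h1 : dimH {x | x ∈ s ∧ f x = 0 ∧ fderiv ℝ f x ≠ 0} ≤ (finrank ℝ E - 1 : ℕ) :=
    dimH_le_of_finrank_ker_le (f := f) (f' := fderiv ℝ f) (fun x hx => hx.2.1)
      (fun x hx => (hf x hx.1).hasFDerivAt.hasFDerivWithinAt)
      (fun x hx => by have := finrank_ker_add_one_le_of_ne_zero hx.2.2; omega)
  refine h1.trans_lt ?_
  exact_mod_cast Nat.sub_lt h0 one_pos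

/-- The cone over the set of zeros at which the derivative has rank at least two is a null set. -/
theorem measure_zero_cone_of_two_le_finrank_range [MeasurableSpace E] [BorelSpace E]
    (μ : Measure E) [μ.IsAddHaarMeasure] {f : E → F} {f' : E → E →L[ℝ] F} {s : Set E}
    (hf : ∀ x ∈ s, f x = 0) (hf' : ∀ x ∈ s, HasFDerivWithinAt f (f' x) s x)
    (hr : ∀ x ∈ s, 2 ≤ finrank ℝ (LinearMap.range (f' x : E →ₗ[ℝ] F))) :
    μ {x | ∃ t : ℝ, ∃ b ∈ s, x = t • b} = 0 := by
  rcases s.eq_empty_or_nonempty with rfl | ⟨x₀, hx₀⟩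
  · simp
  have hE : 2 ≤ finrank ℝ E := (hr x₀ hx₀).trans (LinearMap.finrank_range_le _)
  refine measure_zero_of_dimH_lt_finrank μ ?_
  -- The dimension bound is applied on the product itself: `(t, b) ↦ f b` has derivative of rank at
  -- least two on a space of dimension `n + 1`, hence kernel of dimension at most `n - 1`. The
  -- smooth map `(t, b) ↦ t • b` does not raise dimension.
  let S : Set (ℝ × E) := univ ×ˢ s
  have h1 : dimH S ≤ (finrank ℝ E - 1 : ℕ) := by
    refine dimH_le_of_finrank_ker_le (f := fun q : ℝ × E => f q.2)
      (f' := fun q => (f' q.2).comp (ContinuousLinearMap.snd ℝ ℝ E)) (fun q hq => hf _ hq.2)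
      (fun q hq => ?_) (fun q hq => ?_)
    · exact (hf' q.2 hq.2).comp q hasFDerivWithinAt_snd (fun z hz => hz.2)
    · have h2 := LinearMap.finrank_range_add_finrank_ker
        (((f' q.2).comp (ContinuousLinearMap.snd ℝ ℝ E) : ℝ × E →L[ℝ] F) : ℝ × E →ₗ[ℝ] F)
      have h3 : LinearMap.range (((f' q.2).comp (ContinuousLinearMap.snd ℝ ℝ E) : ℝ × E →L[ℝ] F) :
          ℝ × E →ₗ[ℝ] F) = LinearMap.range (f' q.2 : E →ₗ[ℝ] F) := by
        ext v
        simp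
      rw [h3] at h2
      have h4 := hr q.2 hq.2
      simp only [finrank_prod, finrank_self] at h2
      omega
  have h2 : {x | ∃ t : ℝ, ∃ b ∈ s, x = t • b} ⊆ (fun q : ℝ × E => q.1 • q.2) '' S := by
    rintro x ⟨t, b, hb, rfl⟩
    exact ⟨(t, b), ⟨mem_univ _, hb⟩, rfl⟩
  have h3 : dimH ((fun q : ℝ × E => q.1 • q.2) '' S) ≤ dimH S :=
    ContDiffOn.dimH_image_le (s := univ)
      (contDiff_fst.smul contDiff_snd).contDiffOn convex_univ (subset_univ _)
  refine ((dimH_mono h2).trans (h3.trans h1)).trans_lt ?_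
  exact_mod_cast Nat.sub_lt (by omega) one_pos

end Dimension

/-! ### Enlarging the class of test functions -/

section WeakForm

theorem tendsto_of_norm_sub_le_one_div {G : Type*} [NormedAddCommGroup G] {a : ℕ → G} {b : G}
    (h : ∀ k : ℕ, ‖a k - b‖ ≤ 1 / ((k : ℝ) + 1)) : Tendsto a atTop (𝓝 b) :=
  tendsto_iff_norm_sub_tendsto_zero.2
    (squeeze_zero (fun _ => norm_nonneg _) h tendsto_one_div_add_atTop_nhds_zero_nat)

theorem tendsto_setIntegral_clm_apply {X F : Type*} [MeasurableSpace X] [NormedAddCommGroup F]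
    [NormedSpace ℝ F] (ν : Measure X)
    {Ω : Set X} (hΩ : MeasurableSet Ω) (hν : ν Ω ≠ ⊤)
    {V : X → F →L[ℝ] ℝ} {C M : ℝ} (hV : AEStronglyMeasurable V (ν.restrict Ω))
    (hVC : ∀ x ∈ Ω, ‖V x‖ ≤ C) {A : ℕ → X → F} {B : X → F}
    (hA : ∀ k, AEStronglyMeasurable (A k) (ν.restrict Ω)) (hAM : ∀ k, ∀ x ∈ Ω, ‖A k x‖ ≤ M)
    (hlim : ∀ᵐ x ∂ν.restrict Ω, Tendsto (fun k => A k x) atTop (𝓝 (B x))) :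
    Tendsto (fun k => ∫ x in Ω, V x (A k x) ∂ν) atTop (𝓝 (∫ x in Ω, V x (B x) ∂ν)) := by
  refine tendsto_integral_of_dominated_convergence (fun _ => C * M) (fun k => ?_) ?_ (fun k => ?_)
    ?_
  · exact isBoundedBilinearMap_apply.continuous.comp_aestronglyMeasurable (hV.prodMk (hA k))
  · exact integrableOn_const hν
  · filter_upwards [ae_restrict_mem hΩ] with x hx
    exact (V x).le_of_opNorm_le_of_le (hVC x hx) (hAM k x hx)
  · filter_upwards [hlim] with x hx
    exact ((V x).continuous.tendsto _).comp hx

variable {E F : Type*} [NormedAddCommGroup E] [NormedSpace ℝ E] [FiniteDimensional ℝ E]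
  [NormedAddCommGroup F] [NormedSpace ℝ F] [FiniteDimensional ℝ F]

/-- Take `T v = (1 - b v) • v` with a bump `b` at the origin. The derivative differs from the
identity by a compactly supported function, so it is bounded. -/
theorem exists_truncation (F : Type*) [NormedAddCommGroup F] [NormedSpace ℝ F]
    [FiniteDimensional ℝ F] : ∃ T : F → F, ContDiff ℝ ∞ T ∧ (∀ v, ‖v‖ ≤ 1 → T v = 0) ∧
      (∀ v, 2 ≤ ‖v‖ → T v = v) ∧ (∀ v, ‖T v‖ ≤ ‖v‖) ∧ ∃ C, ∀ v, ‖fderiv ℝ T v‖ ≤ C := by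
  let b : ContDiffBump (0 : F) := ⟨1, 2, one_pos, one_lt_two⟩
  have hb : ContDiff ℝ ∞ (fun v => b v • v) := b.contDiff.smul contDiff_id
  have hT : (fun v => (1 - b v) • v) = fun v => v - b v • v := by
    ext v
    rw [sub_smul, one_smul]
  refine ⟨fun v => (1 - b v) • v, ?_, fun v hv => ?_, fun v hv => ?_, fun v => ?_, ?_⟩
  · rw [hT]
    exact contDiff_id.sub hb
  · have : b v = 1 := b.one_of_mem_closedBall (by simpa using hv)
    simp [this]
  · have : b v = 0 := b.zero_of_le_dist (by simpa using hv)
    simp [this]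
  · rw [norm_smul, Real.norm_eq_abs, abs_of_nonneg (by linarith [b.le_one (x := v)])]
    exact mul_le_of_le_one_left (norm_nonneg _) (by linarith [b.nonneg (x := v)])
  · have hc : HasCompactSupport (fderiv ℝ (fun v => b v • v)) :=
      (b.hasCompactSupport.smul_right (f' := fun v => v)).fderiv ℝ
    obtain ⟨C, hC⟩ := hc.exists_bound_of_continuous (hb.continuous_fderiv (by simp))
    refine ⟨‖ContinuousLinearMap.id ℝ F‖ + C, fun v => ?_⟩
    rw [hT, fderiv_fun_sub differentiableAt_fun_id (hb.differentiable (by simp) v), fderiv_fun_id]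
    exact (norm_sub_le _ _).trans (add_le_add le_rfl (hC v))

/-- Mollification: the derivative falls on `φ`, and both `φ` and its derivative are uniformly
continuous. The radius also stays below the distance that keeps the support in `Ω`. -/
theorem exists_contDiff_approx {Ω : Set E} (hΩ : IsOpen Ω) {φ : E → F} (hφ : ContDiff ℝ 1 φ)
    (hc : HasCompactSupport φ) (hs : tsupport φ ⊆ Ω) {ε : ℝ} (hε : 0 < ε) :
    ∃ ψ : E → F, ContDiff ℝ ∞ ψ ∧ HasCompactSupport ψ ∧ tsupport ψ ⊆ Ω ∧
      ∀ x, ‖ψ x - φ x‖ ≤ ε ∧ ‖fderiv ℝ ψ x - fderiv ℝ φ x‖ ≤ ε := by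
  borelize E
  let μ : Measure E := Measure.addHaar
  obtain ⟨δ, hδ, hδΩ⟩ := hc.isCompact.exists_cthickening_subset_open hΩ hs
  obtain ⟨δ₁, hδ₁, h₁⟩ := Metric.uniformContinuous_iff.1
    (hc.uniformContinuous_of_continuous hφ.continuous) ε hε
  obtain ⟨δ₂, hδ₂, h₂⟩ := Metric.uniformContinuous_iff.1
    ((hc.fderiv ℝ).uniformContinuous_of_continuous (hφ.continuous_fderiv (by simp))) ε hε
  let r := min δ (min δ₁ δ₂)
  have hr : 0 < r := lt_min hδ (lt_min hδ₁ hδ₂)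
  let b : ContDiffBump (0 : E) := ⟨r / 2, r, half_pos hr, half_lt_self hr⟩
  let ψ : E → F := convolution (b.normed μ) φ (ContinuousLinearMap.lsmul ℝ ℝ) μ
  have hfd : ∀ x, HasFDerivAt ψ (convolution (b.normed μ) (fderiv ℝ φ)
      (ContinuousLinearMap.lsmul ℝ ℝ) μ x) x := by
    intro x
    have h := hc.hasFDerivAt_convolution_right (μ := μ) (f := b.normed μ)
      (ContinuousLinearMap.lsmul ℝ ℝ) (b.continuous_normed.locallyIntegrable) hφ x
    convert h using 1
    refine integral_congr_ae (Eventually.of_forall fun t => ?_)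
    ext v
    simp
  have hsupp : tsupport ψ ⊆ Metric.cthickening δ (tsupport φ) := by
    refine closure_minimal ?_ Metric.isClosed_cthickening
    refine (support_convolution_subset_swap _).trans ?_
    rintro _ ⟨x, hx, z, hz, rfl⟩
    rw [b.support_normed_eq, mem_ball_zero_iff] at hz
    refine Metric.mem_cthickening_of_dist_le _ x _ _ (subset_tsupport _ hx) ?_
    simpa using hz.le.trans (min_le_left _ _)
  refine ⟨ψ, ?_, ?_, hsupp.trans hδΩ, fun x => ⟨?_, ?_⟩⟩
  · exact b.hasCompactSupport_normed.contDiff_convolution_left _ b.contDiff_normed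
      (hφ.continuous.locallyIntegrable)
  · exact hc.isCompact.cthickening.of_isClosed_subset (isClosed_tsupport _) hsupp
  · rw [← dist_eq_norm]
    refine b.dist_normed_convolution_le hφ.continuous.aestronglyMeasurable fun z hz => ?_
    exact (h₁ (lt_of_lt_of_le hz ((min_le_right _ _).trans (min_le_left _ _)))).le
  · rw [(hfd x).fderiv, ← dist_eq_norm]
    refine b.dist_normed_convolution_le
      (hφ.continuous_fderiv (by simp)).aestronglyMeasurable fun z hz => ?_
    exact (h₂ (lt_of_lt_of_le hz ((min_le_right _ _).trans (min_le_right _ _)))).le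

variable [MeasurableSpace E] [BorelSpace E] (μ : Measure E) [μ.IsAddHaarMeasure]

/-- The weak form of an equation `div V + g = 0`, tested with smooth functions. -/
def WeakForm (Ω : Set E) (V : E → (E →L[ℝ] F) →L[ℝ] ℝ) (g : E → F →L[ℝ] ℝ) : Prop :=
  ∀ φ : E → F, ContDiff ℝ ∞ φ → HasCompactSupport φ → tsupport φ ⊆ Ω →
    ∫ x in Ω, V x (fderiv ℝ φ x) ∂μ = ∫ x in Ω, g x (φ x) ∂μ

variable {μ}

theorem WeakForm.of_contDiff_one {Ω : Set E} (hΩ : IsOpen Ω) (hΩb : Bornology.IsBounded Ω)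
    {V : E → (E →L[ℝ] F) →L[ℝ] ℝ} {g : E → F →L[ℝ] ℝ} (h : WeakForm μ Ω V g) {C : ℝ}
    (hV : AEStronglyMeasurable V (μ.restrict Ω)) (hVC : ∀ x ∈ Ω, ‖V x‖ ≤ C)
    (hg : AEStronglyMeasurable g (μ.restrict Ω)) (hgC : ∀ x ∈ Ω, ‖g x‖ ≤ C)
    {φ : E → F} (hφ : ContDiff ℝ 1 φ) (hc : HasCompactSupport φ) (hs : tsupport φ ⊆ Ω) :
    ∫ x in Ω, V x (fderiv ℝ φ x) ∂μ = ∫ x in Ω, g x (φ x) ∂μ := by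
  have hμ : μ Ω ≠ ⊤ := hΩb.measure_lt_top.ne
  choose ψ h1 h2 h3 h4 using fun k : ℕ =>
    exists_contDiff_approx hΩ hφ hc hs (Nat.one_div_pos_of_nat (α := ℝ) (n := k))
  obtain ⟨M₁, hM₁⟩ := hc.exists_bound_of_continuous hφ.continuous
  obtain ⟨M₂, hM₂⟩ := (hc.fderiv ℝ).exists_bound_of_continuous (hφ.continuous_fderiv (by simp))
  have hle : ∀ k : ℕ, 1 / ((k : ℝ) + 1) ≤ 1 := fun k => by
    rw [div_le_one (by positivity)]
    linarith [k.cast_nonneg (α := ℝ)]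
  have e1 := tendsto_setIntegral_clm_apply μ hΩ.measurableSet hμ hV hVC
    (A := fun k => fderiv ℝ (ψ k)) (B := fderiv ℝ φ) (M := M₂ + 1)
    (fun k => ((h1 k).continuous_fderiv (by simp)).aestronglyMeasurable)
    (fun k x _ => by
      have := (h4 k x).2.trans (hle k)
      have := norm_le_insert' (fderiv ℝ (ψ k) x) (fderiv ℝ φ x)
      linarith [hM₂ x])
    (Eventually.of_forall fun x => tendsto_of_norm_sub_le_one_div fun k => (h4 k x).2)
  have e2 := tendsto_setIntegral_clm_apply μ hΩ.measurableSet hμ hg hgC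
    (A := ψ) (B := φ) (M := M₁ + 1)
    (fun k => (h1 k).continuous.aestronglyMeasurable)
    (fun k x _ => by
      have := (h4 k x).1.trans (hle k)
      have := norm_le_insert' (ψ k x) (φ x)
      linarith [hM₁ x])
    (Eventually.of_forall fun x => tendsto_of_norm_sub_le_one_div fun k => (h4 k x).1)
  refine tendsto_nhds_unique e1 (e2.congr fun k => ?_)
  exact (h (ψ k) (h1 k) (h2 k) (h3 k)).symm

/-- The weak form holds for test functions that vanish continuously on the boundary of an open
subset, with no regularity of the boundary. -/
theorem WeakForm.of_contDiffOn {Ω : Set E} (hΩ : IsOpen Ω) (hΩb : Bornology.IsBounded Ω)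
    {V : E → (E →L[ℝ] F) →L[ℝ] ℝ} {g : E → F →L[ℝ] ℝ} (h : WeakForm μ Ω V g) {C : ℝ}
    (hV : AEStronglyMeasurable V (μ.restrict Ω)) (hVC : ∀ x ∈ Ω, ‖V x‖ ≤ C)
    (hg : AEStronglyMeasurable g (μ.restrict Ω)) (hgC : ∀ x ∈ Ω, ‖g x‖ ≤ C)
    {U : Set E} (hU : IsOpen U) (hUΩ : U ⊆ Ω) {u : E → F} (huc : Continuous u)
    (hu0 : ∀ x ∉ U, u x = 0) (hu : ContDiffOn ℝ 1 u U) {M : ℝ}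
    (huM : ∀ x ∈ U, ‖fderiv ℝ u x‖ ≤ M) :
    ∫ x in Ω, V x (U.indicator (fderiv ℝ u) x) ∂μ = ∫ x in Ω, g x (u x) ∂μ := by
  obtain ⟨T, hT, hT0, hT1, hTle, L, hL⟩ := exists_truncation F
  have hL0 : 0 ≤ L := (norm_nonneg _).trans (hL 0)
  let c : ℕ → ℝ := fun k => (k : ℝ) + 1
  have hc : ∀ k, 0 < c k := fun k => by positivity
  -- Truncation in the values of `u`: `v k` is supported where `‖u‖ ≥ 1 / c k`, which is compact
  -- inside `U` whatever the shape of the boundary. The rescaling makes the bound on its gradient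
  -- independent of `k`.
  let v : ℕ → E → F := fun k x => (c k)⁻¹ • T (c k • u x)
  have hzero : ∀ k x, ‖c k • u x‖ ≤ 1 → v k x = 0 := fun k x hx => by
    simp only [v, hT0 _ hx, smul_zero]
  have hsupp : ∀ k, tsupport (v k) ⊆ {x | 1 ≤ ‖c k • u x‖} := by
    intro k
    refine closure_minimal (fun x hx => ?_) (isClosed_le continuous_const (by fun_prop))
    by_contra hx'
    exact hx (hzero k x (not_le.1 hx').le)
  have hsuppU : ∀ k, tsupport (v k) ⊆ U := by
    intro k x hx
    by_contra hxU
    have := hsupp k hx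
    simp only [mem_ofPred_eq, hu0 x hxU, smul_zero, norm_zero] at this
    linarith
  have hcomp : ∀ k, HasCompactSupport (v k) := fun k =>
    Metric.isCompact_of_isClosed_isBounded (isClosed_tsupport _)
      (hΩb.subset ((hsuppU k).trans hUΩ))
  have hUat : ∀ x ∈ U, ContDiffAt ℝ 1 u x := fun x hx => hu.contDiffAt (hU.mem_nhds hx)
  have hdv : ∀ k, ContDiff ℝ 1 (v k) := by
    intro k
    rw [contDiff_iff_contDiffAt]
    intro x
    by_cases hx : x ∈ U
    · exact ((hT.of_le (by simp)).contDiffAt.comp x ((hUat x hx).const_smul (c k))).const_smul _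
    · have : x ∉ tsupport (v k) := fun h => hx (hsuppU k h)
      exact contDiffAt_const.congr_of_eventuallyEq (notMem_tsupport_iff_eventuallyEq.1 this)
  have hfd : ∀ k, ∀ x ∈ U, fderiv ℝ (v k) x = (fderiv ℝ T (c k • u x)).comp (fderiv ℝ u x) := by
    intro k x hx
    have h1 := (((hUat x hx).differentiableAt (by simp)).hasFDerivAt.const_smul (c k))
    have h2 := (hT.differentiable (by simp) (c k • u x)).hasFDerivAt
    have h3 := (h2.comp x h1).const_smul (c k)⁻¹
    refine h3.fderiv.trans ?_
    rw [ContinuousLinearMap.comp_smul, smul_smul, inv_mul_cancel₀ (hc k).ne', one_smul]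
  have hfd0 : ∀ k, ∀ x ∉ U, fderiv ℝ (v k) x = 0 := fun k x hx =>
    fderiv_of_notMem_tsupport ℝ fun h => hx (hsuppU k h)
  have hμ : μ Ω ≠ ⊤ := hΩb.measure_lt_top.ne
  obtain ⟨B, hB⟩ : ∃ B, ∀ x, ‖u x‖ ≤ B := by
    have : HasCompactSupport u := Metric.isCompact_of_isClosed_isBounded (isClosed_tsupport _)
      ((hΩb.closure).subset (closure_mono fun x hx => hUΩ (by
        by_contra hxU
        exact hx (hu0 x hxU))))
    exact this.exists_bound_of_continuous huc
  have hlarge : ∀ x, u x ≠ 0 → ∀ᶠ k in atTop, 2 < ‖c k • u x‖ := by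
    intro x hx
    have h1 : Tendsto (fun k => c k * ‖u x‖) atTop atTop :=
      (tendsto_atTop_add_const_right _ _ tendsto_natCast_atTop_atTop).atTop_mul_const
        (norm_pos_iff.2 hx)
    filter_upwards [h1.eventually_gt_atTop 2] with k hk
    rwa [norm_smul, Real.norm_of_nonneg (hc k).le]
  have e1 := tendsto_setIntegral_clm_apply μ hΩ.measurableSet hμ hV hVC
    (A := fun k => fderiv ℝ (v k)) (B := U.indicator (fderiv ℝ u)) (M := L * max M 0)
    (fun k => ((hdv k).continuous_fderiv (by simp)).aestronglyMeasurable)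
    (fun k x _ => by
      by_cases hx : x ∈ U
      · rw [hfd k x hx]
        exact (ContinuousLinearMap.opNorm_comp_le _ _).trans (mul_le_mul (hL _)
          ((huM x hx).trans (le_max_left _ _)) (norm_nonneg _) hL0)
      · rw [hfd0 k x hx, norm_zero]
        positivity)
    (by
      refine ae_restrict_of_ae ?_
      -- Where `u ≠ 0` the truncation is eventually inactive. Where `u = 0` its gradient is zero,
      -- and the limit is right because `fderiv ℝ u` also vanishes there almost everywhere.
      have h0 := measure_zero_setOf_eq_zero_fderiv_ne_zero μ (f := u) (s := U)
        (fun x hx => (hUat x hx).differentiableAt (by simp))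
      filter_upwards [measure_eq_zero_iff_ae_notMem.1 h0] with x hx
      by_cases hxU : x ∈ U
      · rw [indicator_of_mem hxU]
        by_cases hux : u x = 0
        · have h1 : fderiv ℝ u x = 0 := by
            by_contra h1
            exact hx ⟨hxU, hux, h1⟩
          refine tendsto_const_nhds.congr fun k => ?_
          rw [hfd k x hxU, h1, ContinuousLinearMap.comp_zero]
        · refine tendsto_const_nhds.congr' ?_
          filter_upwards [hlarge x hux] with k hk
          have h1 : T =ᶠ[𝓝 (c k • u x)] id := by
            filter_upwards [(isOpen_lt continuous_const continuous_norm).mem_nhds hk] with z hz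
            exact hT1 z (le_of_lt hz)
          rw [hfd k x hxU, h1.fderiv_eq, fderiv_id, ContinuousLinearMap.id_comp]
      · rw [indicator_of_notMem hxU]
        exact tendsto_const_nhds.congr fun k => (hfd0 k x hxU).symm)
  have e2 := tendsto_setIntegral_clm_apply μ hΩ.measurableSet hμ hg hgC
    (A := v) (B := u) (M := B)
    (fun k => (hdv k).continuous.aestronglyMeasurable)
    (fun k x _ => by
      refine le_trans ?_ (hB x)
      simp only [v]
      rw [norm_smul, norm_inv, Real.norm_of_nonneg (hc k).le, inv_mul_le_iff₀ (hc k)]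
      refine (hTle _).trans (le_of_eq ?_)
      rw [norm_smul, Real.norm_of_nonneg (hc k).le])
    (Eventually.of_forall fun x => by
      by_cases hux : u x = 0
      · refine tendsto_const_nhds.congr fun k => ?_
        rw [hzero k x (by simp [hux]), hux]
      · refine tendsto_const_nhds.congr' ?_
        filter_upwards [hlarge x hux] with k hk
        simp only [v]
        rw [hT1 _ hk.le, smul_smul, inv_mul_cancel₀ (hc k).ne', one_smul])
  refine tendsto_nhds_unique e1 (e2.congr fun k => ?_)
  exact (h.of_contDiff_one hΩ hΩb hV hVC hg hgC (hdv k) (hcomp k) ((hsuppU k).trans hUΩ)).symm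

end WeakForm

/-! ### Star-shaped domains and regularity up to the boundary -/

section StarShaped

theorem exists_bound_of_eventually_nhdsWithin {X G : Type*} [TopologicalSpace X]
    [NormedAddCommGroup G] {Ω : Set X} (hK : IsCompact (closure Ω)) {g : X → G}
    (h : ∀ x ∈ closure Ω, ∃ M : ℝ, ∀ᶠ z in 𝓝[Ω] x, ‖g z‖ ≤ M) :
    ∃ M : ℝ, ∀ z ∈ Ω, ‖g z‖ ≤ M := by
  have : ∃ M : ℝ, ∀ z ∈ closure Ω, z ∈ Ω → ‖g z‖ ≤ M := by
    refine hK.induction_on (p := fun s => ∃ M : ℝ, ∀ z ∈ s, z ∈ Ω → ‖g z‖ ≤ M) ⟨0, by simp⟩ ?_ ?_ ?_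
    · rintro s t hst ⟨M, hM⟩
      exact ⟨M, fun z hz => hM z (hst hz)⟩
    · rintro s t ⟨M, hM⟩ ⟨N, hN⟩
      refine ⟨max M N, fun z hz hzΩ => ?_⟩
      rcases hz with hz | hz
      · exact (hM z hz hzΩ).trans (le_max_left _ _)
      · exact (hN z hz hzΩ).trans (le_max_right _ _)
    · intro x hx
      obtain ⟨M, hM⟩ := h x hx
      rw [eventually_nhdsWithin_iff] at hM
      exact ⟨_, mem_nhdsWithin_of_mem_nhds hM, M, fun z hz => hz⟩
  obtain ⟨M, hM⟩ := this
  exact ⟨M, fun z hz => hM z (subset_closure hz) hz⟩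

variable {E F : Type*} [NormedAddCommGroup E] [NormedSpace ℝ E]
  [NormedAddCommGroup F] [NormedSpace ℝ F]

/-- The exit time is the supremum of the times spent in `Ω`: star-shapedness makes these an
interval, and openness excludes its endpoint. -/
theorem exists_exit_time {Ω : Set E} (hΩ : IsOpen Ω) (hb : Bornology.IsBounded Ω)
    (hstar : StarConvex ℝ 0 Ω) {x : E} (hx : x ∈ Ω) (hx0 : x ≠ 0) :
    ∃ τ : ℝ, 1 < τ ∧ (∀ t : ℝ, 0 ≤ t → (t • x ∈ Ω ↔ t < τ)) ∧ τ • x ∈ frontier Ω := by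
  obtain ⟨R, hR⟩ := hb.exists_norm_le
  let S : Set ℝ := {t | 0 ≤ t ∧ t • x ∈ Ω}
  have hxn : 0 < ‖x‖ := norm_pos_iff.2 hx0
  have hS1 : (1 : ℝ) ∈ S := ⟨zero_le_one, by simpa using hx⟩
  have hSb : BddAbove S := by
    refine ⟨R / ‖x‖, fun t ht => ?_⟩
    rw [le_div_iff₀ hxn]
    have := hR _ ht.2
    rwa [norm_smul, Real.norm_of_nonneg ht.1] at this
  have hlt : ∀ t, 0 ≤ t → t < sSup S → t • x ∈ Ω := by
    intro t ht hts
    obtain ⟨s, hs, hts'⟩ := exists_lt_of_lt_csSup ⟨1, hS1⟩ hts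
    have hs0 : 0 < s := ht.trans_lt hts'
    have := hstar.smul_mem hs.2 (t := t / s) (by positivity)
      ((div_le_one hs0).2 hts'.le)
    rwa [smul_smul, div_mul_cancel₀ _ hs0.ne'] at this
  have h1 : 1 ≤ sSup S := le_csSup hSb hS1
  have hτ : sSup S • x ∉ Ω := by
    intro h
    have hc : ContinuousAt (fun t : ℝ => t • x) (sSup S) := by fun_prop
    have h2 : ∀ᶠ t in 𝓝[>] sSup S, t • x ∈ Ω :=
      (hc.eventually (hΩ.mem_nhds h)).filter_mono nhdsWithin_le_nhds
    obtain ⟨t, ht, ht'⟩ := (h2.and self_mem_nhdsWithin).exists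
    have hgt : sSup S < t := ht'
    exact (not_lt.2 (le_csSup hSb (show t ∈ S from ⟨by linarith, ht⟩))) hgt
  have hiff : ∀ t : ℝ, 0 ≤ t → (t • x ∈ Ω ↔ t < sSup S) := by
    refine fun t ht => ⟨fun h => lt_of_le_of_ne (le_csSup hSb ⟨ht, h⟩) ?_, hlt t ht⟩
    rintro rfl
    exact hτ h
  refine ⟨sSup S, (hiff 1 zero_le_one).1 hS1.2, hiff, ?_, ?_⟩
  · have hc : Tendsto (fun t : ℝ => t • x) (𝓝[<] sSup S) (𝓝 (sSup S • x)) :=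
      (show ContinuousAt (fun t : ℝ => t • x) (sSup S) by fun_prop).tendsto.mono_left
        nhdsWithin_le_nhds
    refine mem_closure_of_tendsto hc ?_
    filter_upwards [Ioo_mem_nhdsLT (show (0 : ℝ) < sSup S by linarith)] with t ht
    exact hlt t ht.1.le ht.2
  · rwa [hΩ.interior_eq]

/-- Derivatives within the closure need not be unique at a boundary point. One local choice is taken
from the definition of `C²`; inside `Ω` it agrees with `fderiv ℝ y`, so its continuity gives the
limit of the interior gradients. -/
theorem exists_hasFDerivWithinAt_closure {Ω : Set E} (hΩ : IsOpen Ω) {y : E → F}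
    (hy : ContDiffOn ℝ 2 y (closure Ω)) {x : E} (hx : x ∈ closure Ω) :
    ∃ (A : E →L[ℝ] F) (M : ℝ), HasFDerivWithinAt y A (closure Ω) x ∧
      Tendsto (fderiv ℝ y) (𝓝[Ω] x) (𝓝 A) ∧
      ∀ᶠ z in 𝓝[Ω] x, ‖fderiv ℝ (fderiv ℝ y) z‖ ≤ M := by
  have hnhds : ∀ z ∈ Ω, closure Ω ∈ 𝓝 z := fun z hz =>
    mem_of_superset (hΩ.mem_nhds hz) subset_closure
  have hle : 𝓝[Ω] x ≤ 𝓝[insert x (closure Ω)] x :=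
    nhdsWithin_mono x (subset_closure.trans (subset_insert _ _))
  have h2 : ContDiffWithinAt ℝ (1 + 1) y (closure Ω) x := by
    rw [one_add_one_eq_two]
    exact hy x hx
  obtain ⟨u, hu, -, -, f', hf', hcf'⟩ :=
    (contDiffWithinAt_succ_iff_hasFDerivWithinAt' (by simp)).1 h2
  have h1 : ContDiffWithinAt ℝ (0 + 1) f' (closure Ω) x := by simpa using hcf'
  obtain ⟨u₂, hu₂, -, -, f'', hf'', hcf''⟩ :=
    (contDiffWithinAt_succ_iff_hasFDerivWithinAt' (by simp)).1 h1
  have hxu : x ∈ u := mem_of_mem_nhdsWithin (mem_insert _ _) hu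
  have heq : ∀ᶠ z in 𝓝[Ω] x, fderiv ℝ y z = f' z := by
    filter_upwards [hle hu, self_mem_nhdsWithin] with z hz hzΩ
    exact ((hf' z hz).hasFDerivAt (hnhds z hzΩ)).fderiv
  refine ⟨f' x, ‖f'' x‖ + 1, hf' x hxu, ?_, ?_⟩
  · refine ((hcf'.continuousWithinAt).mono subset_closure).tendsto.congr' ?_
    exact heq.mono fun z hz => hz.symm
  · have hb : ∀ᶠ z in 𝓝[Ω] x, ‖f'' z‖ < ‖f'' x‖ + 1 :=
      ((hcf''.continuousWithinAt).mono subset_closure).norm.eventually_lt_const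
        (lt_add_one _)
    filter_upwards [hle hu₂, self_mem_nhdsWithin, eventually_eventually_nhdsWithin.2 heq, hb]
      with z hz hzΩ hzeq hzb
    rw [hΩ.nhdsWithin_eq hzΩ] at hzeq
    rw [EventuallyEq.fderiv_eq hzeq, ((hf'' z hz).hasFDerivAt (hnhds z hzΩ)).fderiv]
    exact hzb.le

theorem exists_fderiv_bound {Ω : Set E} (hΩ : IsOpen Ω) (hK : IsCompact (closure Ω)) {y : E → F}
    (hy : ContDiffOn ℝ 2 y (closure Ω)) :
    ∃ M : ℝ, 0 ≤ M ∧ (∀ z ∈ Ω, ‖fderiv ℝ y z‖ ≤ M) ∧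
      ∀ z ∈ Ω, ‖fderiv ℝ (fderiv ℝ y) z‖ ≤ M := by
  obtain ⟨M, hM⟩ := exists_bound_of_eventually_nhdsWithin hK (g := fderiv ℝ y) fun x hx => by
    obtain ⟨A, -, -, hA, -⟩ := exists_hasFDerivWithinAt_closure hΩ hy hx
    exact ⟨‖A‖ + 1, (hA.norm.eventually_lt_const (lt_add_one _)).mono fun _ h => h.le⟩
  obtain ⟨N, hN⟩ := exists_bound_of_eventually_nhdsWithin hK (g := fderiv ℝ (fderiv ℝ y))
    fun x hx => by
      obtain ⟨-, N, -, -, hN⟩ := exists_hasFDerivWithinAt_closure hΩ hy hx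
      exact ⟨N, hN⟩
  exact ⟨max (max M N) 0, le_max_right _ _,
    fun z hz => (hM z hz).trans ((le_max_left _ _).trans (le_max_left _ _)),
    fun z hz => (hN z hz).trans ((le_max_right _ _).trans (le_max_left _ _))⟩

theorem norm_sub_le_of_smul_mem {Ω : Set E} (hstar : StarConvex ℝ 0 Ω) {y : E → F}
    (hy : ∀ x ∈ Ω, DifferentiableAt ℝ y x) {M : ℝ} (hM : ∀ x ∈ Ω, ‖fderiv ℝ y x‖ ≤ M)
    {x : E} {t : ℝ} (ht : 1 ≤ t) (htx : t • x ∈ Ω) :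
    ‖y (t • x) - y x‖ ≤ M * ((t - 1) * ‖x‖) := by
  have hsub : segment ℝ 0 (t • x) ⊆ Ω := hstar.segment_subset htx
  have hx : x ∈ segment ℝ 0 (t • x) := by
    refine ⟨1 - t⁻¹, t⁻¹, by linarith [inv_le_one_of_one_le₀ ht], by positivity, by ring, ?_⟩
    rw [smul_zero, zero_add, smul_smul, inv_mul_cancel₀ (by linarith), one_smul]
  have h := (convex_segment (𝕜 := ℝ) 0 (t • x)).norm_image_sub_le_of_norm_fderiv_le
    (fun z hz => hy z (hsub hz)) (fun z hz => hM z (hsub hz)) hx (right_mem_segment ℝ 0 (t • x))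
  have h2 : t • x - x = (t - 1) • x := by rw [sub_smul, one_smul]
  rwa [h2, norm_smul, Real.norm_of_nonneg (by linarith)] at h

/-- If `t • x` has left `Ω`, the mean value inequality is used only up to the exit time, where the
extension is already zero. -/
theorem norm_indicator_smul_sub_le {Ω : Set E} (hΩ : IsOpen Ω) (hb : Bornology.IsBounded Ω)
    (hstar : StarConvex ℝ 0 Ω) {y : E → F} (hyc : Continuous (Ω.indicator y))
    (hy : ∀ x ∈ Ω, DifferentiableAt ℝ y x) {M : ℝ} (hM : ∀ x ∈ Ω, ‖fderiv ℝ y x‖ ≤ M)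
    {x : E} (hx : x ∈ Ω) {t : ℝ} (ht : 1 ≤ t) :
    ‖Ω.indicator y (t • x) - Ω.indicator y x‖ ≤ M * ((t - 1) * ‖x‖) := by
  have hM0 : 0 ≤ M := (norm_nonneg _).trans (hM x hx)
  by_cases htx : t • x ∈ Ω
  · rw [indicator_of_mem htx, indicator_of_mem hx]
    exact norm_sub_le_of_smul_mem hstar hy hM ht htx
  have hx0 : x ≠ 0 := by
    rintro rfl
    exact htx (by simpa using hx)
  obtain ⟨τ, hτ1, hτ, -⟩ := exists_exit_time hΩ hb hstar hx hx0
  have hτt : τ ≤ t := not_lt.1 fun h => htx ((hτ t (by linarith)).2 h)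
  have hτx : τ • x ∉ Ω := fun h => lt_irrefl _ ((hτ τ (by linarith)).1 h)
  have h := norm_image_sub_le_of_norm_deriv_right_le_segment (a := 1) (b := τ)
    (f := fun s : ℝ => Ω.indicator y (s • x)) (f' := fun s : ℝ => fderiv ℝ y (s • x) x)
    (C := M * ‖x‖) (by fun_prop) (fun s hs => ?_) (fun s hs => ?_) τ ⟨hτ1.le, le_rfl⟩
  · rw [one_smul, indicator_of_notMem hτx] at h
    rw [indicator_of_notMem htx]
    refine h.trans ?_
    rw [mul_assoc, mul_comm ‖x‖]
    gcongr
  · have hsx : s • x ∈ Ω := (hτ s (by linarith [hs.1])).2 hs.2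
    have h1 : HasFDerivAt (Ω.indicator y) (fderiv ℝ y (s • x)) (s • x) := by
      refine (hy _ hsx).hasFDerivAt.congr_of_eventuallyEq ?_
      filter_upwards [hΩ.mem_nhds hsx] with z hz
      rw [indicator_of_mem hz]
    have h2 : HasDerivAt (fun s : ℝ => s • x) x s := by
      simpa using (hasDerivAt_id s).smul_const x
    exact (h1.comp_hasDerivAt s h2).hasDerivWithinAt
  · have hsx : s • x ∈ Ω := (hτ s (by linarith [hs.1])).2 hs.2
    exact (fderiv ℝ y (s • x)).le_of_opNorm_le (hM _ hsx) x

end StarShaped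

/-! ### The layer lost under dilation -/

theorem tsum_le_of_support_subsingleton {f : ℕ → ℝ≥0∞} {c : ℝ≥0∞}
    (hf : ∀ i j, f i ≠ 0 → f j ≠ 0 → i = j) (hc : ∀ i, f i ≤ c) : ∑' i, f i ≤ c := by
  by_cases h : ∃ i, f i ≠ 0
  · obtain ⟨i, hi⟩ := h
    rw [tsum_eq_single i fun j hj => by_contra fun h => hj (hf j i h hi)]
    exact hc i
  · have : f = fun _ => 0 := funext fun i => by_contra fun hi => h ⟨i, hi⟩
    simp [this]

section Layer

variable {E : Type*} [NormedAddCommGroup E] [NormedSpace ℝ E]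

/-- The part of `Ω` that leaves `Ω` under dilation by `t`. -/
def outerLayer (Ω : Set E) (t : ℝ) : Set E := {x | x ∈ Ω ∧ t • x ∉ Ω}

theorem measurableSet_outerLayer [MeasurableSpace E] [BorelSpace E] {Ω : Set E} (hΩ : IsOpen Ω)
    (t : ℝ) : MeasurableSet (outerLayer Ω t) :=
  hΩ.measurableSet.inter ((hΩ.preimage (continuous_const_smul t)).measurableSet.compl)

/-- If `i < j`, star-shapedness pulls `t ^ j • x ∈ Ω` back to `t ^ (i + 1) • x ∈ Ω`, so `t ^ i • x`
is not in the layer. -/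
theorem eq_of_pow_smul_mem_outerLayer {Ω : Set E} (hstar : StarConvex ℝ 0 Ω) {t : ℝ} (ht : 1 < t)
    {x : E} {i j : ℕ} (hi : t ^ i • x ∈ outerLayer Ω t) (hj : t ^ j • x ∈ outerLayer Ω t) :
    i = j := by
  wlog hij : i < j generalizing i j
  · rcases lt_trichotomy i j with h | h | h
    · exact this hi hj h
    · exact h
    · exact (this hj hi h).symm
  exfalso
  apply hi.2
  have h0 : 0 < t := by linarith
  have h1 : t ^ (i + 1) ≤ t ^ j := pow_le_pow_right₀ ht.le hij
  have h2 := hstar.smul_mem hj.1 (t := t ^ (i + 1) / t ^ j) (by positivity)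
    ((div_le_one (by positivity)).2 h1)
  rwa [smul_smul, div_mul_cancel₀ _ (by positivity), pow_succ', ← smul_smul] at h2

theorem mem_of_smul_mem_of_one_le {Ω : Set E} (hstar : StarConvex ℝ 0 Ω) {t : ℝ} (ht : 1 ≤ t)
    {x : E} (hx : t • x ∈ Ω) : x ∈ Ω := by
  have h := hstar.smul_mem hx (t := t⁻¹) (by positivity) (inv_le_one_of_one_le₀ ht)
  rwa [smul_smul, inv_mul_cancel₀ (by linarith), one_smul] at h

variable [FiniteDimensional ℝ E] [MeasurableSpace E] [BorelSpace E]
  (μ : Measure E) [μ.IsAddHaarMeasure]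

theorem lintegral_comp_smul {f : E → ℝ≥0∞} (hf : Measurable f) {t : ℝ} (ht : 0 < t) :
    ∫⁻ x, f (t • x) ∂μ = ENNReal.ofReal (t ^ finrank ℝ E)⁻¹ * ∫⁻ x, f x ∂μ := by
  rw [← lintegral_map hf (measurable_const_smul t), Measure.map_addHaar_smul μ ht.ne',
    lintegral_smul_measure, abs_of_pos (by positivity), smul_eq_mul]

/-- The `k`-th term integrates to `t ^ (-nk)` times the layer integral, and the geometric series
sums to `1 / (1 - t ^ (-n))`. The prefactor carries the whole factor `t - 1`, so the remaining
integral need only tend to zero. -/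
theorem setLIntegral_outerLayer_eq {Ω : Set E} (hΩ : IsOpen Ω) [Nontrivial E]
    {q : E → ℝ≥0∞} (hq : Measurable q) {t : ℝ} (ht : 1 < t) :
    ∫⁻ x in outerLayer Ω t, q x ∂μ = ENNReal.ofReal (1 - (t ^ finrank ℝ E)⁻¹) *
      ∫⁻ x, ∑' k : ℕ, (outerLayer Ω t).indicator q (t ^ k • x) ∂μ := by
  have h0 : 0 < t := by linarith
  have hD := measurableSet_outerLayer hΩ t
  have hqD : Measurable ((outerLayer Ω t).indicator q) := hq.indicator hD
  set r : ℝ := (t ^ finrank ℝ E)⁻¹ with hr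
  have hr0 : 0 ≤ r := by positivity
  have hr1 : r < 1 := inv_lt_one_of_one_lt₀ (one_lt_pow₀ ht finrank_pos.ne')
  rw [lintegral_tsum (f := fun k x => (outerLayer Ω t).indicator q (t ^ k • x))
    fun k => (hqD.comp (measurable_const_smul (t ^ k))).aemeasurable]
  have h1 : ∀ k : ℕ, ∫⁻ x, (outerLayer Ω t).indicator q (t ^ k • x) ∂μ =
      ENNReal.ofReal r ^ k * ∫⁻ x in outerLayer Ω t, q x ∂μ := by
    intro k
    rw [lintegral_comp_smul μ hqD (by positivity), lintegral_indicator hD,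
      ← ENNReal.ofReal_pow hr0, hr, inv_pow, ← pow_mul, ← pow_mul, mul_comm k]
  simp_rw [h1]
  rw [ENNReal.tsum_mul_right, ENNReal.tsum_geometric, ← mul_assoc,
    ENNReal.ofReal_sub _ hr0, ENNReal.ofReal_one, ENNReal.mul_inv_cancel, one_mul]
  · exact (tsub_pos_iff_lt.2 (ENNReal.ofReal_lt_one.2 hr1)).ne'
  · exact ENNReal.sub_ne_top ENNReal.one_ne_top

theorem one_sub_inv_pow_le {t : ℝ} (ht : 1 ≤ t) (n : ℕ) : 1 - (t ^ n)⁻¹ ≤ n * (t - 1) := by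
  have h0 : 0 < t := by linarith
  have h1 : (-2 : ℝ) ≤ t⁻¹ - 1 := by linarith [inv_pos.2 h0]
  have h2 := one_add_mul_le_pow h1 n
  rw [add_sub_cancel, inv_pow] at h2
  have h3 : 1 - t⁻¹ ≤ t - 1 := by
    have : t * t⁻¹ = 1 := mul_inv_cancel₀ h0.ne'
    nlinarith [inv_pos.2 h0, sq_nonneg (t - 1)]
  nlinarith [n.cast_nonneg (α := ℝ)]

/-- A bounded density that tends to zero at almost every boundary point, as seen from the centre of
a star-shaped domain, has mass `o(t - 1)` in the layer between `t⁻¹ Ω` and `Ω`. -/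
theorem eventually_setLIntegral_outerLayer_le [Nontrivial E] {Ω : Set E} (hΩ : IsOpen Ω)
    (hb : Bornology.IsBounded Ω) (hstar : StarConvex ℝ 0 Ω) {q : E → ℝ≥0∞} (hq : Measurable q)
    {C : ℝ≥0} (hC : ∀ x ∈ Ω, q x ≤ C)
    (hlim : ∀ᵐ x ∂μ, ∀ τ : ℝ, τ • x ∈ frontier Ω → Tendsto q (𝓝[Ω] (τ • x)) (𝓝 0))
    {ε : ℝ} (hε : 0 < ε) :
    ∀ᶠ t in 𝓝[>] (1 : ℝ), ∫⁻ x in outerLayer Ω t, q x ∂μ ≤ ENNReal.ofReal (ε * (t - 1)) := by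
  let h : ℝ → E → ℝ≥0∞ := fun t x => ∑' k : ℕ, (outerLayer Ω t).indicator q (t ^ k • x)
  have hsub : ∀ t, 1 < t → ∀ x, ∀ k : ℕ, (outerLayer Ω t).indicator q (t ^ k • x) ≠ 0 →
      t ^ k • x ∈ outerLayer Ω t := fun t _ x k hk => by
    by_contra hx
    exact hk (indicator_of_notMem hx _)
  have hle : ∀ t, 1 < t → ∀ x, ∀ c, (∀ k : ℕ, t ^ k • x ∈ outerLayer Ω t → q (t ^ k • x) ≤ c) →
      h t x ≤ c := by
    intro t ht x c hc
    refine tsum_le_of_support_subsingleton (fun i j hi hj => eq_of_pow_smul_mem_outerLayer hstar ht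
      (hsub t ht x i hi) (hsub t ht x j hj)) fun k => ?_
    by_cases hx : t ^ k • x ∈ outerLayer Ω t
    · rw [indicator_of_mem hx]
      exact hc k hx
    · rw [indicator_of_notMem hx]
      exact zero_le
  have hmem : ∀ t, 1 < t → ∀ x, ∀ k : ℕ, t ^ k • x ∈ outerLayer Ω t → x ∈ Ω :=
    fun t ht x k hk => mem_of_smul_mem_of_one_le hstar (one_le_pow₀ ht.le) hk.1
  -- At most one term of the series is nonzero at each `x`, and none for `x ∉ Ω`, so `C` on `Ω`
  -- dominates.
  have hT : Tendsto (fun t => ∫⁻ x, h t x ∂μ) (𝓝[>] (1 : ℝ)) (𝓝 (∫⁻ _, 0 ∂μ)) := by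
    refine tendsto_lintegral_filter_of_dominated_convergence (Ω.indicator fun _ => (C : ℝ≥0∞))
      ?_ ?_ ?_ ?_
    · refine Eventually.of_forall fun t => Measurable.tsum fun k => ?_
      exact (hq.indicator (measurableSet_outerLayer hΩ t)).comp (measurable_const_smul (t ^ k))
    · filter_upwards [self_mem_nhdsWithin] with t ht
      refine Eventually.of_forall fun x => hle t ht x _ fun k hk => ?_
      rw [indicator_of_mem (hmem t ht x k hk)]
      exact hC _ hk.1
    · rw [lintegral_indicator hΩ.measurableSet, setLIntegral_const]
      exact ENNReal.mul_ne_top ENNReal.coe_ne_top hb.measure_lt_top.ne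
    · have hne : ∀ᵐ x ∂μ, x ≠ 0 := by
        simp [ae_iff]
      filter_upwards [hlim, hne] with x hx hx0
      by_cases hxΩ : x ∈ Ω
      · obtain ⟨τ, hτ1, hτ, hτf⟩ := exists_exit_time hΩ hb hstar hxΩ hx0
        rw [ENNReal.tendsto_nhds_zero]
        intro η hη
        have h1 : Tendsto (fun s : ℝ => s • x) (𝓝[<] τ) (𝓝[Ω] (τ • x)) := by
          refine tendsto_nhdsWithin_iff.2 ⟨?_, ?_⟩
          · exact (show ContinuousAt (fun s : ℝ => s • x) τ by fun_prop).tendsto.mono_left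
              nhdsWithin_le_nhds
          · filter_upwards [Ioo_mem_nhdsLT (show (0 : ℝ) < τ by linarith)] with s hs
            exact (hτ s hs.1.le).2 hs.2
        -- A layer point `t ^ k • x` satisfies `τ / t ≤ t ^ k < τ`, so it approaches the exit point
        -- as `t ↓ 1`, for whichever `k` occurs.
        have h2 := ENNReal.tendsto_nhds_zero.1 ((hx τ hτf).comp h1) η hη
        obtain ⟨δ, hδ, hδ'⟩ := (mem_nhdsLT_iff_exists_Ioo_subset).1 h2
        have h3 : Tendsto (fun t : ℝ => τ / t) (𝓝[>] (1 : ℝ)) (𝓝 τ) := by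
          have : ContinuousAt (fun t : ℝ => τ / t) 1 :=
            continuousAt_const.div continuousAt_id one_ne_zero
          simpa using this.tendsto.mono_left nhdsWithin_le_nhds
        filter_upwards [h3.eventually_const_lt hδ, self_mem_nhdsWithin] with t ht ht1
        have ht1' : 1 < t := ht1
        refine hle t ht1 x η fun k hk => ?_
        have hpos : 0 < t := by linarith
        refine hδ' ⟨ht.trans_le ?_, (hτ _ (by positivity)).1 hk.1⟩
        rw [div_le_iff₀ hpos, ← pow_succ]
        refine not_lt.1 fun h4 => hk.2 ?_
        rw [smul_smul, ← pow_succ']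
        exact (hτ _ (by positivity)).2 h4
      · refine tendsto_const_nhds.congr' ?_
        filter_upwards [self_mem_nhdsWithin] with t ht
        refine le_antisymm zero_le (hle t ht x 0 fun k hk => ?_)
        exact absurd (hmem t ht x k hk) hxΩ
  rw [lintegral_zero] at hT
  have hn : (0 : ℝ) < finrank ℝ E := by exact_mod_cast finrank_pos
  have hev := ENNReal.tendsto_nhds_zero.1 hT (ENNReal.ofReal (ε / finrank ℝ E))
    (ENNReal.ofReal_pos.2 (by positivity))
  filter_upwards [hev, self_mem_nhdsWithin] with t ht ht1
  have ht1' : 1 < t := ht1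
  rw [setLIntegral_outerLayer_eq μ hΩ hq ht1]
  refine (mul_le_mul' (ENNReal.ofReal_le_ofReal (one_sub_inv_pow_le ht1'.le _)) ht).trans ?_
  rw [← ENNReal.ofReal_mul (by nlinarith)]
  refine ENNReal.ofReal_le_ofReal (le_of_eq ?_)
  field_simp

end Layer

/-! ### Euler's relation and uniform first-order remainders -/

section Homogeneous

variable {X : Type*} [NormedAddCommGroup X] [NormedSpace ℝ X]

theorem fderiv_apply_self_of_homogeneous {f : X → ℝ} {p : ℝ}
    (hf : ∀ t : ℝ, 0 < t → ∀ x, f (t • x) = t ^ p * f x) {x : X} (hd : DifferentiableAt ℝ f x) :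
    fderiv ℝ f x x = p * f x := by
  have h1 : HasDerivAt (fun t : ℝ => t • x) x 1 := by
    simpa using (hasDerivAt_id (1 : ℝ)).smul_const x
  have hd' : HasFDerivAt f (fderiv ℝ f x) ((1 : ℝ) • x) := by simpa using hd.hasFDerivAt
  have h2 := hd'.comp_hasDerivAt (1 : ℝ) h1
  have h3 : HasDerivAt (fun t : ℝ => t ^ p * f x) (p * f x) 1 := by
    simpa using (Real.hasDerivAt_rpow_const (x := 1) (p := p) (Or.inl one_ne_zero)).mul_const (f x)
  refine h2.unique (h3.congr_of_eventuallyEq ?_)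
  filter_upwards [lt_mem_nhds (zero_lt_one (α := ℝ))] with t ht
  exact hf t ht x

/-- Uniform continuity of the derivative on the ball of radius `K + 1`, with the mean value
inequality. It stands in for second derivatives of `W` and `Φ`. -/
theorem exists_uniform_remainder [FiniteDimensional ℝ X] {f : X → ℝ} (hf : ContDiff ℝ 1 f) (K : ℝ)
    {ε : ℝ} (hε : 0 < ε) : ∃ δ > 0, ∀ a b, ‖a‖ ≤ K → ‖b - a‖ ≤ δ →
      |f b - f a - fderiv ℝ f a (b - a)| ≤ ε * ‖b - a‖ := by
  have := FiniteDimensional.proper_real X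
  have huc := (isCompact_closedBall (0 : X) (K + 1)).uniformContinuousOn_of_continuous
    (hf.continuous_fderiv (by simp)).continuousOn
  obtain ⟨δ, hδ, h⟩ := Metric.uniformContinuousOn_iff.1 huc ε hε
  refine ⟨min 1 (δ / 2), by positivity, fun a b ha hab => ?_⟩
  have hsub : ∀ z ∈ Metric.closedBall a ‖b - a‖, ‖fderiv ℝ f z - fderiv ℝ f a‖ ≤ ε := by
    intro z hz
    have hz' : dist z a ≤ min 1 (δ / 2) := (Metric.mem_closedBall.1 hz).trans hab
    rw [← dist_eq_norm]
    refine (h z ?_ a ?_ ?_).le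
    · rw [mem_closedBall_zero_iff]
      have h1 := norm_le_norm_add_norm_sub' z a
      rw [← dist_eq_norm] at h1
      linarith [min_le_left 1 (δ / 2)]
    · rw [mem_closedBall_zero_iff]
      linarith
    · linarith [min_le_right 1 (δ / 2)]
  have h2 := (convex_closedBall a ‖b - a‖).norm_image_sub_le_of_norm_fderiv_le'
    (fun z _ => hf.differentiable (by simp) z) hsub
    (Metric.mem_closedBall_self (norm_nonneg _)) (by rw [Metric.mem_closedBall, dist_eq_norm])
  rwa [Real.norm_eq_abs] at h2

theorem exists_bound_comp {S : Type*} [FiniteDimensional ℝ X] {G : Type*} [NormedAddCommGroup G]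
    {f : X → G} (hf : Continuous f) {s : Set S} {u : S → X} {K : ℝ} (hu : ∀ x ∈ s, ‖u x‖ ≤ K) :
    ∃ C, ∀ x ∈ s, ‖f (u x)‖ ≤ C := by
  have := FiniteDimensional.proper_real X
  obtain ⟨C, hC⟩ := (isCompact_closedBall (0 : X) K).exists_bound_of_continuousOn hf.continuousOn
  exact ⟨C, fun x hx => hC _ (mem_closedBall_zero_iff.2 (hu x hx))⟩

end Homogeneous

/-! ### Sign of the boundary contribution -/

section Identity

variable {E F : Type*} [NormedAddCommGroup E] [NormedSpace ℝ E] [FiniteDimensional ℝ E]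
  [NormedAddCommGroup F] [NormedSpace ℝ F]
  [MeasurableSpace E] [BorelSpace E] (μ : Measure E) [μ.IsAddHaarMeasure]

theorem setIntegral_comp_smul_preimage {G : Type*} [NormedAddCommGroup G] [NormedSpace ℝ G]
    {Ω : Set E} (hΩ : IsOpen Ω) (f : E → G) {t : ℝ} (ht : 0 < t) :
    ∫ x in (fun x => t • x) ⁻¹' Ω, f (t • x) ∂μ = (t ^ finrank ℝ E)⁻¹ • ∫ x in Ω, f x ∂μ := by
  rw [← integral_indicator hΩ.measurableSet,
    ← integral_indicator (hΩ.preimage (continuous_const_smul t)).measurableSet]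
  have h := Measure.integral_comp_smul μ (Ω.indicator f) t
  rw [abs_of_pos (by positivity)] at h
  exact h

variable [FiniteDimensional ℝ F]

/-- Only the negative part of `w(∇y)` matters. It tends to zero at boundary points where the
limiting derivative has rank at most one, and the rays through the other boundary points form a null
set. -/
theorem eventually_le_setIntegral_outerLayer [Nontrivial E] {w : (E →L[ℝ] F) → ℝ}
    (hw : Continuous w)
    (hrank : ∀ A : E →L[ℝ] F, finrank ℝ (LinearMap.range (A : E →ₗ[ℝ] F)) ≤ 1 → 0 ≤ w A)
    {Ω : Set E} (hΩ : IsOpen Ω) (hb : Bornology.IsBounded Ω) (hstar : StarConvex ℝ 0 Ω)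
    {y : E → F} (hy : ContDiffOn ℝ 2 y (closure Ω)) (hy0 : ∀ x ∈ frontier Ω, y x = 0)
    {ε : ℝ} (hε : 0 < ε) :
    ∀ᶠ t in 𝓝[>] (1 : ℝ), -(ε * (t - 1)) ≤ ∫ x in outerLayer Ω t, w (fderiv ℝ y x) ∂μ := by
  have := FiniteDimensional.proper_real E
  obtain ⟨M, hM0, hM, -⟩ := exists_fderiv_bound hΩ hb.isCompact_closure hy
  obtain ⟨C, hC⟩ := exists_bound_comp hw hM
  have hmeas : Measurable fun x => w (fderiv ℝ y x) :=
    hw.measurable.comp (measurable_fderiv ℝ y)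
  have hex : ∀ x, ∃ A : E →L[ℝ] F, x ∈ closure Ω →
      HasFDerivWithinAt y A (closure Ω) x ∧ Tendsto (fderiv ℝ y) (𝓝[Ω] x) (𝓝 A) := by
    intro x
    by_cases hx : x ∈ closure Ω
    · obtain ⟨A, -, h1, h2, -⟩ := exists_hasFDerivWithinAt_closure hΩ hy hx
      exact ⟨A, fun _ => ⟨h1, h2⟩⟩
    · exact ⟨0, fun h => absurd h hx⟩
  choose G hG using hex
  have hnull := measure_zero_cone_of_two_le_finrank_range μ (f := y) (f' := G)
    (s := {b | b ∈ frontier Ω ∧ 2 ≤ finrank ℝ (LinearMap.range (G b : E →ₗ[ℝ] F))})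
    (fun b hb => hy0 b hb.1)
    (fun b hb => (hG b (frontier_subset_closure hb.1)).1.mono
      fun z hz => frontier_subset_closure hz.1)
    (fun b hb => hb.2)
  have hlim : ∀ᵐ x ∂μ, ∀ τ : ℝ, τ • x ∈ frontier Ω →
      Tendsto (fun x => ENNReal.ofReal (-w (fderiv ℝ y x))) (𝓝[Ω] (τ • x)) (𝓝 0) := by
    filter_upwards [measure_eq_zero_iff_ae_notMem.1 hnull] with x hx τ hτ
    have hτ0 : τ ≠ 0 := by
      rintro rfl
      rw [zero_smul] at hτ
      have hne : Ω.Nonempty := closure_nonempty_iff.1 ⟨0, frontier_subset_closure hτ⟩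
      exact hτ.2 (by rw [hΩ.interior_eq]; exact hstar.mem hne)
    have hr : finrank ℝ (LinearMap.range (G (τ • x) : E →ₗ[ℝ] F)) ≤ 1 := by
      by_contra h
      refine hx ⟨τ⁻¹, τ • x, ⟨hτ, by omega⟩, ?_⟩
      rw [smul_smul, inv_mul_cancel₀ hτ0, one_smul]
    have h1 := (hG _ (frontier_subset_closure hτ)).2
    have h2 : Tendsto (fun x => ENNReal.ofReal (-w (fderiv ℝ y x))) (𝓝[Ω] (τ • x))
        (𝓝 (ENNReal.ofReal (-w (G (τ • x))))) :=
      (ENNReal.continuous_ofReal.tendsto _).comp ((hw.tendsto _).comp h1).neg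
    rwa [ENNReal.ofReal_of_nonpos (by linarith [hrank _ hr])] at h2
  have hev := eventually_setLIntegral_outerLayer_le μ hΩ hb hstar
    (q := fun x => ENNReal.ofReal (-w (fderiv ℝ y x))) hmeas.neg.ennreal_ofReal
    (C := C.toNNReal) (fun x hx => ENNReal.ofReal_le_ofReal
      ((neg_le_abs _).trans (hC x hx))) hlim hε
  filter_upwards [hev, self_mem_nhdsWithin] with t ht ht1
  have ht1' : 1 < t := ht1
  have hint : IntegrableOn (fun x => w (fderiv ℝ y x)) (outerLayer Ω t) μ := by
    refine Measure.integrableOn_of_bounded (M := C)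
      ((measure_mono fun x hx => hx.1).trans_lt hb.measure_lt_top).ne
      hmeas.aestronglyMeasurable ?_
    filter_upwards [ae_restrict_mem (measurableSet_outerLayer hΩ t)] with x hx
    exact hC x hx.1
  rw [integral_eq_lintegral_pos_part_sub_lintegral_neg_part hint]
  have h1 := ENNReal.toReal_le_of_le_ofReal (by nlinarith) ht
  linarith [ENNReal.toReal_nonneg (a := ∫⁻ x in outerLayer Ω t, ENNReal.ofReal (w (fderiv ℝ y x)) ∂μ)]

end Identity

/-! ### Dilated test functions and the Pohozaev inequality -/

section Identity

variable {E F : Type*} [NormedAddCommGroup E] [NormedSpace ℝ E] [FiniteDimensional ℝ E]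
  [NormedAddCommGroup F] [NormedSpace ℝ F] [FiniteDimensional ℝ F]
  [MeasurableSpace E] [BorelSpace E] {μ : Measure E} [μ.IsAddHaarMeasure]

/-- The dilate vanishes off `t⁻¹ Ω ⊆ Ω`, so the truncation argument applies. The value `t = 1` is
kept because it gives the test with `y` itself. -/
theorem WeakForm.dilation {Ω : Set E} (hΩ : IsOpen Ω) (hΩb : Bornology.IsBounded Ω)
    (hstar : StarConvex ℝ 0 Ω)
    {V : E → (E →L[ℝ] F) →L[ℝ] ℝ} {g : E → F →L[ℝ] ℝ} (h : WeakForm μ Ω V g) {C : ℝ}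
    (hV : ContinuousOn V Ω) (hVC : ∀ x ∈ Ω, ‖V x‖ ≤ C)
    (hg : ContinuousOn g Ω) (hgC : ∀ x ∈ Ω, ‖g x‖ ≤ C)
    {y : E → F} (hyc : Continuous (Ω.indicator y)) (hy : ContDiffOn ℝ 1 y Ω) {M : ℝ}
    (hM : ∀ x ∈ Ω, ‖fderiv ℝ y x‖ ≤ M) {t : ℝ} (ht : 1 ≤ t) :
    ∫ x in Ω, V x (((fun x => t • x) ⁻¹' Ω).indicator (fun x => t • fderiv ℝ y (t • x)) x) ∂μ =
      ∫ x in Ω, g x (Ω.indicator y (t • x)) ∂μ := by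
  have hU : IsOpen ((fun x : E => t • x) ⁻¹' Ω) := hΩ.preimage (continuous_const_smul t)
  have hY : ContDiffOn ℝ 1 (Ω.indicator y) Ω := hy.congr fun x hx => indicator_of_mem hx y
  have hfd : ∀ x ∈ (fun x : E => t • x) ⁻¹' Ω,
      fderiv ℝ (fun x => Ω.indicator y (t • x)) x = t • fderiv ℝ y (t • x) := by
    intro x hx
    have hy' : HasFDerivAt (Ω.indicator y) (fderiv ℝ y (t • x)) (t • x) := by
      refine ((hy.contDiffAt (hΩ.mem_nhds hx)).differentiableAt
        (by simp)).hasFDerivAt.congr_of_eventuallyEq ?_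
      filter_upwards [hΩ.mem_nhds hx] with z hz
      rw [indicator_of_mem hz]
    have h2 : HasFDerivAt (fun x : E => t • x) (t • ContinuousLinearMap.id ℝ E) x :=
      (hasFDerivAt_id x).const_smul t
    refine (hy'.comp x h2).fderiv.trans ?_
    rw [ContinuousLinearMap.comp_smul, ContinuousLinearMap.comp_id]
  have key := h.of_contDiffOn hΩ hΩb (hV.aestronglyMeasurable hΩ.measurableSet) hVC
    (hg.aestronglyMeasurable hΩ.measurableSet) hgC hU
    (fun x hx => mem_of_smul_mem_of_one_le hstar ht hx)
    (u := fun x => Ω.indicator y (t • x)) (by fun_prop)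
    (fun x hx => indicator_of_notMem (s := Ω) hx y)
    (hY.comp (contDiff_const_smul t).contDiffOn fun x hx => hx) (M := t * M)
    (fun x hx => by
      rw [hfd x hx, norm_smul, Real.norm_of_nonneg (by linarith)]
      exact mul_le_mul_of_nonneg_left (hM _ hx) (by linarith))
  rw [← key]
  refine integral_congr_ae (Eventually.of_forall fun x => ?_)
  simp only
  congr 1
  by_cases hx : x ∈ (fun x : E => t • x) ⁻¹' Ω
  · rw [indicator_of_mem hx, indicator_of_mem hx, hfd x hx]
  · rw [indicator_of_notMem hx, indicator_of_notMem hx]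

theorem integrableOn_of_continuousOn_of_bound {G : Type*} [NormedAddCommGroup G] {Ω : Set E}
    (hΩ : IsOpen Ω) (hb : Bornology.IsBounded Ω) {f : E → G} (hf : ContinuousOn f Ω) {C : ℝ}
    (hC : ∀ x ∈ Ω, ‖f x‖ ≤ C) : IntegrableOn f Ω μ :=
  have := FiniteDimensional.proper_real E
  have : IsFiniteMeasure (μ.restrict Ω) := ⟨by
    rw [Measure.restrict_apply_univ]
    exact hb.measure_lt_top⟩
  Integrable.of_bound (hf.aestronglyMeasurable hΩ.measurableSet) C
    (ae_restrict_of_forall_mem hΩ.measurableSet hC)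

theorem le_zero_of_eventually_le_mul {k : ℝ → ℝ} {d : ℝ} (hk : HasDerivAt k d 1)
    (h : ∀ ε > 0, ∀ᶠ t in 𝓝[>] (1 : ℝ), k t - k 1 ≤ ε * (t - 1)) : d ≤ 0 := by
  refine le_of_forall_pos_le_add fun ε hε => ?_
  have h1 := (hasDerivAt_iff_tendsto_slope.1 hk).mono_left
    (nhdsWithin_mono (1 : ℝ) (show Ioi (1 : ℝ) ⊆ {1}ᶜ from fun t ht => ne_of_gt ht))
  rw [zero_add]
  refine le_of_tendsto h1 ?_
  filter_upwards [h ε hε, self_mem_nhdsWithin] with t ht ht1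
  have ht1' : 0 < t - 1 := sub_pos.2 ht1
  rw [slope_def_field, div_le_iff₀ ht1']
  exact ht

/-- The Pohozaev identity as an inequality on a star-shaped domain, with no regularity of the
boundary. -/
theorem pohozaev_inequality [Nontrivial E] {w : (E →L[ℝ] F) → ℝ} (hw : ContDiff ℝ 1 w)
    {p : ℝ} (hp : 1 ≤ p) (hhom : ∀ t : ℝ, 0 < t → ∀ A, w (t • A) = t ^ p * w A)
    (hrank : ∀ A : E →L[ℝ] F, finrank ℝ (LinearMap.range (A : E →ₗ[ℝ] F)) ≤ 1 → 0 ≤ w A)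
    {Ω : Set E} (hΩ : IsOpen Ω) (hb : Bornology.IsBounded Ω) (hstar : StarConvex ℝ 0 Ω)
    {Φ : F → ℝ} (hΦ : ContDiff ℝ 1 Φ) (hΦ0 : Φ 0 = 0)
    {y : E → F} (hy : ContDiffOn ℝ 2 y (closure Ω)) (hy0 : ∀ x ∈ frontier Ω, y x = 0)
    (h : WeakForm μ Ω (fun x => fderiv ℝ w (fderiv ℝ y x)) (fun x => fderiv ℝ Φ (y x))) :
    (finrank ℝ E - p) * ∫ x in Ω, fderiv ℝ Φ (y x) (y x) ∂μ ≤
      finrank ℝ E * p * ∫ x in Ω, Φ (y x) ∂μ := by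
  have := FiniteDimensional.proper_real E
  have := FiniteDimensional.proper_real F
  set n := finrank ℝ E with hn
  have hp0 : 0 < p := by linarith
  have hμ : μ Ω ≠ ⊤ := hb.measure_lt_top.ne
  -- bounds and continuity on `Ω`
  obtain ⟨M, hM0, hM, hM2⟩ := exists_fderiv_bound hΩ hb.isCompact_closure hy
  obtain ⟨R, hR0, hR⟩ := hb.exists_pos_norm_le
  obtain ⟨B, hB⟩ := hb.isCompact_closure.exists_bound_of_continuousOn hy.continuousOn
  have hB' : ∀ x ∈ Ω, ‖y x‖ ≤ B := fun x hx => hB x (subset_closure hx)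
  have hyΩ : ContDiffOn ℝ 2 y Ω := hy.mono subset_closure
  have hyd : ∀ x ∈ Ω, DifferentiableAt ℝ y x := fun x hx =>
    (hyΩ.contDiffAt (hΩ.mem_nhds hx)).differentiableAt (by simp)
  have hDy : ContDiffOn ℝ 1 (fderiv ℝ y) Ω := hyΩ.fderiv_of_isOpen hΩ (by norm_num)
  have hDyd : ∀ x ∈ Ω, DifferentiableAt ℝ (fderiv ℝ y) x := fun x hx =>
    (hDy.contDiffAt (hΩ.mem_nhds hx)).differentiableAt (by simp)
  have hYc : Continuous (Ω.indicator y) := continuous_indicator hy0 hy.continuousOn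
  have hdw : Continuous (fderiv ℝ w) := hw.continuous_fderiv (by simp)
  have hdΦ : Continuous (fderiv ℝ Φ) := hΦ.continuous_fderiv (by simp)
  obtain ⟨C₁, hC₁⟩ := exists_bound_comp (X := E →L[ℝ] F) (G := (E →L[ℝ] F) →L[ℝ] ℝ) hdw hM
  obtain ⟨C₂, hC₂⟩ := exists_bound_comp (X := F) (G := F →L[ℝ] ℝ) hdΦ hB'
  obtain ⟨C₃, hC₃⟩ := exists_bound_comp hw.continuous hM
  have hVc : ContinuousOn (fun x => fderiv ℝ w (fderiv ℝ y x)) Ω :=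
    hdw.comp_continuousOn hDy.continuousOn
  have hgc : ContinuousOn (fun x => fderiv ℝ Φ (y x)) Ω := hdΦ.comp_continuousOn hyΩ.continuousOn
  have hweak := fun t (ht : (1 : ℝ) ≤ t) => h.dilation hΩ hb hstar (C := max C₁ C₂) hVc
    (fun x hx => (hC₁ x hx).trans (le_max_left _ _)) hgc
    (fun x hx => (hC₂ x hx).trans (le_max_right _ _)) hYc (hyΩ.of_le (by norm_num)) hM ht
  set I := ∫ x in Ω, w (fderiv ℝ y x) ∂μ with hI
  set J := ∫ x in Ω, Φ (y x) ∂μ with hJ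
  have hEuler : ∀ A, fderiv ℝ w A A = p * w A := fun A =>
    fderiv_apply_self_of_homogeneous hhom (hw.differentiable (by simp) A)
  -- testing with `y` itself
  have hself : p * I = ∫ x in Ω, fderiv ℝ Φ (y x) (y x) ∂μ := by
    rw [hI, ← integral_const_mul]
    refine Eq.trans (setIntegral_congr_fun hΩ.measurableSet fun x hx => ?_)
      ((hweak 1 le_rfl).trans (setIntegral_congr_fun hΩ.measurableSet fun x hx => ?_))
    · have hx' : x ∈ (fun x : E => (1 : ℝ) • x) ⁻¹' Ω := by simpa using hx
      rw [indicator_of_mem hx', one_smul, one_smul, hEuler]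
    · rw [one_smul, indicator_of_mem hx]
  -- the inequality for the dilated function
  have key : ∀ ε > 0, ∀ᶠ t in 𝓝[>] (1 : ℝ),
      ((t ^ n)⁻¹ * J - (t ^ n)⁻¹ * (t ^ p * I)) - (J - I) ≤ ε * (t - 1) := by
    intro ε hε
    set v := μ.real Ω with hv
    have hv0 : 0 ≤ v := measureReal_nonneg
    -- For `1 ≤ t < 2` this is a common Lipschitz constant in `t - 1`: `2MR` comes from moving the
    -- point in `∇y`, and `M` from the factor `t` in `t ∇y(tx)`.
    set N := M * (2 * R + 1) with hN
    have hN0 : 0 ≤ N := by positivity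
    -- Half of `ε` pays for the two Taylor remainders, of `w` and of `Φ`; the other half is for the
    -- layer. The `+ 1` in the witness covers `N * v = 0`.
    obtain ⟨η, hη, hηv⟩ : ∃ η > 0, 2 * (η * N * v) ≤ ε / 2 := by
      refine ⟨ε / (4 * (N * v + 1)), by positivity, ?_⟩
      have h1 : 0 ≤ N * v := by positivity
      rw [show 2 * (ε / (4 * (N * v + 1)) * N * v) = ε / 2 * ((N * v) / (N * v + 1)) by
        field_simp; ring]
      exact mul_le_of_le_one_right (by positivity) ((div_le_one (by positivity)).2 (by linarith))
    obtain ⟨δ₁, hδ₁, hrem₁⟩ := exists_uniform_remainder hw M hη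
    obtain ⟨δ₂, hδ₂, hrem₂⟩ := exists_uniform_remainder hΦ B hη
    have hsmall : Tendsto (fun t : ℝ => N * (t - 1)) (𝓝[>] 1) (𝓝 0) := by
      have : ContinuousAt (fun t : ℝ => N * (t - 1)) 1 := by fun_prop
      simpa using this.tendsto.mono_left nhdsWithin_le_nhds
    have hlayer := eventually_le_setIntegral_outerLayer μ hw.continuous hrank hΩ hb hstar hy hy0
      (show 0 < ε / (2 * p) by positivity)
    filter_upwards [hsmall.eventually_lt_const hδ₁, hsmall.eventually_lt_const hδ₂, hlayer,
      Ioo_mem_nhdsGT (show (1 : ℝ) < 2 by norm_num)] with t ht₁ ht₂ htl ht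
    have ht1 : 1 ≤ t := ht.1.le
    have ht0 : 0 < t := by linarith
    set U : Set E := (fun x => t • x) ⁻¹' Ω with hUdef
    have hU : IsOpen U := hΩ.preimage (continuous_const_smul t)
    have hUΩ : U ⊆ Ω := fun x hx => mem_of_smul_mem_of_one_le hstar ht1 hx
    have hUb : Bornology.IsBounded U := hb.subset hUΩ
    have hint : ∀ {f : E → ℝ} {C : ℝ}, ContinuousOn f U → (∀ x ∈ U, ‖f x‖ ≤ C) →
        IntegrableOn (U.indicator f) Ω μ := fun hf hC =>
      ((integrable_indicator_iff hU.measurableSet).2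
        (integrableOn_of_continuousOn_of_bound hU hUb hf hC)).integrableOn
    have hintU : ∀ f : E → ℝ, ∫ x in Ω, U.indicator f x ∂μ = ∫ x in U, f x ∂μ := fun f => by
      rw [setIntegral_indicator hU.measurableSet, inter_eq_right.2 hUΩ]
    have hDt : ContinuousOn (fun x => t • fderiv ℝ y (t • x)) U :=
      (hDy.continuousOn.comp (continuous_const_smul t).continuousOn fun x hx => hx).const_smul t
    have hYt : Continuous fun x => Ω.indicator y (t • x) :=
      hYc.comp (continuous_const_smul t)
    have hYB : ∀ x, ‖Ω.indicator y x‖ ≤ max B 0 := fun x => by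
      by_cases hx : x ∈ Ω
      · rw [indicator_of_mem hx]
        exact (hB' x hx).trans (le_max_left _ _)
      · rw [indicator_of_notMem hx, norm_zero]
        exact le_max_right _ _
    -- the integrals of the dilated energy
    have ha : ∫ x in Ω, U.indicator (fun x => w (t • fderiv ℝ y (t • x))) x ∂μ =
        (t ^ n)⁻¹ * (t ^ p * I) := by
      rw [hintU]
      simp_rw [hhom t ht0]
      rw [setIntegral_comp_smul_preimage μ hΩ (fun x => t ^ p * w (fderiv ℝ y x)) ht0,
        integral_const_mul, smul_eq_mul]
    have hc : ∫ x in Ω, Φ (Ω.indicator y (t • x)) ∂μ = (t ^ n)⁻¹ * J := by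
      have h1 : ∀ x, Φ (Ω.indicator y (t • x)) = U.indicator (fun x => Φ (y (t • x))) x := by
        intro x
        by_cases hx : x ∈ U
        · rw [indicator_of_mem hx, indicator_of_mem (show t • x ∈ Ω from hx)]
        · rw [indicator_of_notMem hx, indicator_of_notMem (show t • x ∉ Ω from hx), hΦ0]
      simp_rw [h1]
      rw [hintU, setIntegral_comp_smul_preimage μ hΩ (fun x => Φ (y x)) ht0, smul_eq_mul]
    -- the equation tested with the dilated function
    have hvv : ∫ x in Ω, U.indicator
          (fun x => fderiv ℝ w (fderiv ℝ y x) (t • fderiv ℝ y (t • x))) x ∂μ =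
        ∫ x in Ω, fderiv ℝ Φ (y x) (Ω.indicator y (t • x)) ∂μ := by
      rw [← hweak t ht1]
      refine integral_congr_ae (Eventually.of_forall fun x => ?_)
      by_cases hx : x ∈ U
      · simp only
        rw [indicator_of_mem hx, indicator_of_mem hx]
      · simp only
        rw [indicator_of_notMem hx, indicator_of_notMem hx, map_zero]
    -- integrability
    have hia := hint (f := fun x => w (t • fderiv ℝ y (t • x))) (C := t ^ p * C₃)
      (hw.continuous.comp_continuousOn hDt) (fun x hx => by
        rw [hhom t ht0, norm_mul, Real.norm_of_nonneg (by positivity)]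
        exact mul_le_mul_of_nonneg_left (hC₃ _ hx) (by positivity))
    have hiv := hint (f := fun x => fderiv ℝ w (fderiv ℝ y x) (t • fderiv ℝ y (t • x)))
      (C := C₁ * (t * M)) ((hVc.mono hUΩ).clm_apply hDt) (fun x hx => by
        refine ContinuousLinearMap.le_of_opNorm_le_of_le _ (hC₁ x (hUΩ hx)) ?_
        rw [norm_smul, Real.norm_of_nonneg ht0.le]
        exact mul_le_mul_of_nonneg_left (hM _ hx) ht0.le)
    have hib : IntegrableOn (fun x => w (fderiv ℝ y x)) Ω μ :=
      integrableOn_of_continuousOn_of_bound hΩ hb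
        (hw.continuous.comp_continuousOn hDy.continuousOn) hC₃
    have hD := measurableSet_outerLayer hΩ t
    have hDΩ : outerLayer Ω t ⊆ Ω := fun x hx => hx.1
    have hiD : IntegrableOn ((outerLayer Ω t).indicator fun x => w (fderiv ℝ y x)) Ω μ :=
      hib.indicator hD
    have hig : IntegrableOn (fun x => fderiv ℝ Φ (y x) (Ω.indicator y (t • x))) Ω μ :=
      integrableOn_of_continuousOn_of_bound hΩ hb (hgc.clm_apply hYt.continuousOn)
        (fun x hx => ContinuousLinearMap.le_of_opNorm_le_of_le _ (hC₂ x hx) (hYB _))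
    have hig' : IntegrableOn (fun x => fderiv ℝ Φ (y x) (y x)) Ω μ :=
      integrableOn_of_continuousOn_of_bound hΩ hb (hgc.clm_apply hyΩ.continuousOn)
        (fun x hx => ContinuousLinearMap.le_of_opNorm_le_of_le _ (hC₂ x hx) (hB' x hx))
    obtain ⟨C₄, hC₄⟩ := exists_bound_comp (s := univ) hΦ.continuous
      (u := Ω.indicator y) (fun x _ => hYB x)
    have hiΦt : IntegrableOn (fun x => Φ (Ω.indicator y (t • x))) Ω μ :=
      integrableOn_of_continuousOn_of_bound hΩ hb (hΦ.continuous.comp hYt).continuousOn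
        (fun x _ => hC₄ (t • x) (mem_univ _))
    have hiΦ : IntegrableOn (fun x => Φ (y x)) Ω μ :=
      integrableOn_of_continuousOn_of_bound hΩ hb (hΦ.continuous.comp_continuousOn hyΩ.continuousOn)
        (fun x hx => by simpa [indicator_of_mem hx] using hC₄ x (mem_univ _))
    have hconst : ∀ c : ℝ, IntegrableOn (fun _ => c) Ω μ := fun c => integrableOn_const hμ
    -- pointwise estimates
    have hpt₁ : ∀ x ∈ Ω, -(η * (N * (t - 1))) +
          (p - 1) * (outerLayer Ω t).indicator (fun x => w (fderiv ℝ y x)) x ≤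
        U.indicator (fun x => w (t • fderiv ℝ y (t • x))) x - w (fderiv ℝ y x) -
          U.indicator (fun x => fderiv ℝ w (fderiv ℝ y x) (t • fderiv ℝ y (t • x))) x +
          p * w (fderiv ℝ y x) := by
      intro x hx
      by_cases hxU : x ∈ U
      · have hxD : x ∉ outerLayer Ω t := fun h => h.2 hxU
        rw [indicator_of_mem hxU, indicator_of_mem hxU, indicator_of_notMem hxD]
        have hclose : ‖t • fderiv ℝ y (t • x) - fderiv ℝ y x‖ ≤ N * (t - 1) := by
          have e1 := norm_sub_le_of_smul_mem hstar hDyd hM2 ht1 hxU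
          have e2 : t • fderiv ℝ y (t • x) - fderiv ℝ y x =
              t • (fderiv ℝ y (t • x) - fderiv ℝ y x) + (t - 1) • fderiv ℝ y x := by
            rw [smul_sub, sub_smul, one_smul]
            abel
          rw [e2]
          refine (norm_add_le _ _).trans ?_
          rw [norm_smul, norm_smul, Real.norm_of_nonneg ht0.le,
            Real.norm_of_nonneg (show (0 : ℝ) ≤ t - 1 by linarith)]
          have e3 : t * ‖fderiv ℝ y (t • x) - fderiv ℝ y x‖ ≤ 2 * (M * ((t - 1) * R)) := by
            refine mul_le_mul ht.2.le (e1.trans ?_) (norm_nonneg _) (by norm_num)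
            gcongr
            exact hR x hx
          have e4 : (t - 1) * ‖fderiv ℝ y x‖ ≤ (t - 1) * M :=
            mul_le_mul_of_nonneg_left (hM x hx) (by linarith)
          rw [hN]
          linarith
        have hr := hrem₁ _ _ (hM x hx) (hclose.trans ht₁.le)
        rw [map_sub, hEuler] at hr
        have := (abs_le.1 hr).1
        have := mul_le_mul_of_nonneg_left hclose hη.le
        linarith
      -- In the layer the dilated gradient is zero and not close to `∇y`, so no expansion is used:
      -- `-w + p w` is exactly the boundary term `(p - 1) w`.
      · have hxD : x ∈ outerLayer Ω t := ⟨hx, hxU⟩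
        rw [indicator_of_notMem hxU, indicator_of_notMem hxU, indicator_of_mem hxD]
        have : 0 ≤ η * (N * (t - 1)) := mul_nonneg hη.le (mul_nonneg hN0 (by linarith))
        linarith
    have hpt₂ : ∀ x ∈ Ω, Φ (Ω.indicator y (t • x)) - Φ (y x) - η * (N * (t - 1)) ≤
        fderiv ℝ Φ (y x) (Ω.indicator y (t • x)) - fderiv ℝ Φ (y x) (y x) := by
      intro x hx
      have hclose : ‖Ω.indicator y (t • x) - y x‖ ≤ N * (t - 1) := by
        have e1 := norm_indicator_smul_sub_le hΩ hb hstar hYc hyd hM hx ht1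
        rw [indicator_of_mem hx] at e1
        refine e1.trans ?_
        have e2 : M * ((t - 1) * ‖x‖) ≤ M * ((t - 1) * R) := by
          gcongr
          exact hR x hx
        have e3 : 0 ≤ M * (R + 1) * (t - 1) := mul_nonneg (by positivity) (by linarith)
        rw [hN]
        linarith
      have hr := hrem₂ _ _ (hB' x hx) (hclose.trans ht₂.le)
      rw [map_sub] at hr
      have := (abs_le.1 hr).2
      have := mul_le_mul_of_nonneg_left hclose hη.le
      linarith
    -- integration
    have hs₁ := setIntegral_mono_on ((hconst _).add (hiD.const_mul (p - 1)))
      (((hia.sub hib).sub hiv).add (hib.const_mul p)) hΩ.measurableSet hpt₁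
    have hs₂ := setIntegral_mono_on ((hiΦt.sub hiΦ).sub (hconst _)) (hig.sub hig')
      hΩ.measurableSet hpt₂
    rw [integral_add' (hconst _) (hiD.const_mul (p - 1)),
      integral_add' ((hia.sub hib).sub hiv) (hib.const_mul p), integral_sub' (hia.sub hib) hiv,
      integral_sub' hia hib, integral_const_mul, integral_const_mul, setIntegral_const,
      setIntegral_indicator hD, inter_eq_right.2 hDΩ, ha, hvv, smul_eq_mul] at hs₁
    rw [integral_sub' (hiΦt.sub hiΦ) (hconst _), integral_sub' hiΦt hiΦ, integral_sub' hig hig',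
      setIntegral_const, hc, smul_eq_mul, ← hself] at hs₂
    -- Here `p ≥ 1` is essential: the lower bound for the layer integral keeps its direction.
    have hs₃ : (p - 1) * -(ε / (2 * p) * (t - 1)) ≤
        (p - 1) * ∫ x in outerLayer Ω t, w (fderiv ℝ y x) ∂μ :=
      mul_le_mul_of_nonneg_left htl (by linarith)
    have hs₄ : (p - 1) * (ε / (2 * p) * (t - 1)) ≤ ε / 2 * (t - 1) := by
      have : (p - 1) * (ε / (2 * p) * (t - 1)) = ε / 2 * (t - 1) * ((p - 1) / p) := by
        field_simp
      rw [this]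
      exact mul_le_of_le_one_right (mul_nonneg (by positivity) (by linarith))
        ((div_le_one hp0).2 (by linarith))
    have hs₅ : 2 * (η * N * v) * (t - 1) ≤ ε / 2 * (t - 1) :=
      mul_le_mul_of_nonneg_right hηv (by linarith)
    linarith
  have hder : HasDerivAt (fun t : ℝ => (t ^ n)⁻¹ * J - (t ^ n)⁻¹ * (t ^ p * I))
      (-n * J - (-n * I + p * I)) 1 := by
    have h1 : HasDerivAt (fun t : ℝ => (t ^ n)⁻¹) (-n) 1 :=
      ((hasDerivAt_pow n (1 : ℝ)).inv (by simp)).congr_deriv (by simp)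
    have h2 : HasDerivAt (fun t : ℝ => t ^ p * I) (p * I) 1 := by
      simpa using (Real.hasDerivAt_rpow_const (x := 1) (p := p) (Or.inl one_ne_zero)).mul_const I
    exact ((h1.mul_const J).sub (h1.mul h2)).congr_deriv (by simp)
  -- This reads `(n - p) I ≤ n J`; multiplying by `p` and using `p I = ∫ Φ_y(y)·y` gives the claim.
  have hfin := le_zero_of_eventually_le_mul hder (by simpa using key)
  rw [← hself]
  nlinarith

end Identity

/-! ### Uniqueness of the zero solution -/

section Uniqueness

theorem WeakForm.translate {E F : Type*} [NormedAddCommGroup E] [NormedSpace ℝ E]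
    [NormedAddCommGroup F] [NormedSpace ℝ F] [MeasurableSpace E] [BorelSpace E] {μ : Measure E}
    [μ.IsAddHaarMeasure] {Ω : Set E} {V : E → (E →L[ℝ] F) →L[ℝ] ℝ} {g : E → F →L[ℝ] ℝ}
    (h : WeakForm μ Ω V g) (a : E) :
    WeakForm μ ((fun x => a + x) ⁻¹' Ω) (fun x => V (a + x)) (fun x => g (a + x)) := by
  intro φ hφ hc hs
  let e : E ≃ₜ E := (Homeomorph.addLeft a).symm
  have he : ∀ x, e x = -a + x := fun x => rfl
  have hts : tsupport (fun x => φ (-a + x)) = e ⁻¹' tsupport φ :=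
    tsupport_comp_eq_preimage φ e
  have key := h (fun x => φ (-a + x)) (hφ.comp (contDiff_const.add contDiff_id))
    (hc.comp_homeomorph e) (by
      rw [hts]
      intro x hx
      have := hs hx
      simpa [he] using this)
  have hmp := measurePreserving_add_left μ a
  have hme := measurableEmbedding_addLeft a
  have h1 := hmp.setIntegral_preimage_emb hme
    (fun x => V x (fderiv ℝ (fun x => φ (-a + x)) x)) Ω
  have h2 := hmp.setIntegral_preimage_emb hme (fun x => g x (φ (-a + x))) Ω
  rw [key, ← h2] at h1
  simpa [fderiv_comp_add_left] using h1

variable {E F : Type*} [NormedAddCommGroup E] [NormedSpace ℝ E] [FiniteDimensional ℝ E]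
  [NormedAddCommGroup F] [NormedSpace ℝ F]

/-- Divide the hypothesis at `t • v` by `t` and let `t ↓ 0`: both sides become multiples of the
derivative at zero along `v`. Replacing `v` by `-v` forces equality, and `b < a` then forces zero.
-/
theorem fderiv_zero_eq_zero_of_forall_le {Φ : F → ℝ} (hΦ : ContDiff ℝ 1 Φ) (hΦ0 : Φ 0 = 0)
    {a b : ℝ} (hba : b < a) (h : ∀ η, a * Φ η ≤ b * fderiv ℝ Φ η η) : fderiv ℝ Φ 0 = 0 := by
  have key : ∀ v, a * fderiv ℝ Φ 0 v ≤ b * fderiv ℝ Φ 0 v := by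
    intro v
    have h1 : HasDerivAt (fun t : ℝ => Φ (t • v)) (fderiv ℝ Φ 0 v) 0 := by
      have hd : HasFDerivAt Φ (fderiv ℝ Φ 0) ((0 : ℝ) • v) := by
        simpa using (hΦ.differentiable (by simp) (0 : F)).hasFDerivAt
      have hs : HasDerivAt (fun t : ℝ => t • v) v 0 := by
        simpa using (hasDerivAt_id (0 : ℝ)).smul_const v
      exact hd.comp_hasDerivAt (0 : ℝ) hs
    have h2 := (hasDerivAt_iff_tendsto_slope.1 h1).mono_left
      (nhdsWithin_mono (0 : ℝ) (show Ioi (0 : ℝ) ⊆ {0}ᶜ from fun t ht => ne_of_gt ht))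
    have h3 : Tendsto (fun t : ℝ => fderiv ℝ Φ (t • v) v) (𝓝[>] 0) (𝓝 (fderiv ℝ Φ 0 v)) := by
      have hc : Continuous fun t : ℝ => fderiv ℝ Φ (t • v) v :=
        ((hΦ.continuous_fderiv (by simp)).comp (by fun_prop)).clm_apply continuous_const
      simpa using (hc.tendsto 0).mono_left nhdsWithin_le_nhds
    refine le_of_tendsto_of_tendsto (h2.const_mul a) (h3.const_mul b) ?_
    filter_upwards [self_mem_nhdsWithin] with t ht
    have ht' : 0 < t := ht
    have h4 := h (t • v)
    rw [map_smul, smul_eq_mul] at h4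
    rw [slope_def_field, zero_smul, hΦ0, sub_zero, sub_zero, ← mul_div_assoc, div_le_iff₀ ht']
    linarith
  ext v
  have h1 := key v
  have h2 := key (-v)
  rw [map_neg] at h2
  have h3 : (a - b) * fderiv ℝ Φ 0 v = 0 := by linarith
  exact (mul_eq_zero.1 h3).resolve_left (by linarith)

variable [MeasurableSpace E] [BorelSpace E] {μ : Measure E} [μ.IsAddHaarMeasure]
  [FiniteDimensional ℝ F]

theorem eq_zero_of_weakForm [Nontrivial E] {w : (E →L[ℝ] F) → ℝ} (hw : ContDiff ℝ 1 w)
    {p : ℝ} (hp : 1 ≤ p) (hhom : ∀ t : ℝ, 0 < t → ∀ A, w (t • A) = t ^ p * w A)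
    (hrank : ∀ A : E →L[ℝ] F, finrank ℝ (LinearMap.range (A : E →ₗ[ℝ] F)) ≤ 1 → 0 ≤ w A)
    {Ω : Set E} (hΩ : IsOpen Ω) (hb : Bornology.IsBounded Ω) (hstar : StarConvex ℝ 0 Ω)
    {Φ : F → ℝ} (hΦ : ContDiff ℝ 1 Φ) (hΦ0 : Φ 0 = 0)
    (hle : ∀ η, (finrank ℝ E : ℝ) * p * Φ η ≤ (finrank ℝ E - p) * fderiv ℝ Φ η η)
    (hZ : connectedComponentIn
      {η | (finrank ℝ E : ℝ) * p * Φ η = (finrank ℝ E - p) * fderiv ℝ Φ η η} 0 = {0})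
    {y : E → F} (hy : ContDiffOn ℝ 2 y (closure Ω)) (hy0 : ∀ x ∈ frontier Ω, y x = 0)
    (h : WeakForm μ Ω (fun x => fderiv ℝ w (fderiv ℝ y x)) (fun x => fderiv ℝ Φ (y x))) :
    ∀ x ∈ closure Ω, y x = 0 := by
  have := FiniteDimensional.proper_real E
  set n : ℝ := (finrank ℝ E : ℝ)
  have hineq := pohozaev_inequality hw hp hhom hrank hΩ hb hstar hΦ hΦ0 hy hy0 h
  have hYc : Continuous (Ω.indicator y) := continuous_indicator hy0 hy.continuousOn
  have hc₁ : ContinuousOn (fun x => fderiv ℝ Φ (y x) (y x)) (closure Ω) :=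
    (((hΦ.continuous_fderiv (by simp)).comp_continuousOn hy.continuousOn)).clm_apply hy.continuousOn
  have hc₂ : ContinuousOn (fun x => Φ (y x)) (closure Ω) :=
    hΦ.continuous.comp_continuousOn hy.continuousOn
  have hi₁ : IntegrableOn (fun x => fderiv ℝ Φ (y x) (y x)) Ω μ :=
    (hc₁.integrableOn_compact hb.isCompact_closure).mono_set subset_closure
  have hi₂ : IntegrableOn (fun x => Φ (y x)) Ω μ :=
    (hc₂.integrableOn_compact hb.isCompact_closure).mono_set subset_closure
  let f : E → ℝ := fun x => (n - p) * fderiv ℝ Φ (y x) (y x) - n * p * Φ (y x)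
  have hf0 : ∀ x, 0 ≤ f x := fun x => sub_nonneg.2 (hle (y x))
  have hfi : IntegrableOn f Ω μ := (hi₁.const_mul _).sub (hi₂.const_mul _)
  have hfint : ∫ x in Ω, f x ∂μ = 0 := by
    refine le_antisymm ?_ (integral_nonneg hf0)
    have : ∫ x in Ω, f x ∂μ = (n - p) * ∫ x in Ω, fderiv ℝ Φ (y x) (y x) ∂μ -
        n * p * ∫ x in Ω, Φ (y x) ∂μ := by
      rw [← integral_const_mul, ← integral_const_mul]
      exact integral_sub (hi₁.const_mul _) (hi₂.const_mul _)
    rw [this]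
    linarith
  have hfae : f =ᵐ[μ.restrict Ω] fun _ => 0 :=
    (integral_eq_zero_iff_of_nonneg hf0 hfi).1 hfint
  have hfΩ : EqOn f (fun _ => 0) Ω := by
    -- A nonnegative integrand with zero integral vanishes almost everywhere, and by continuity
    -- everywhere on the open set.
    refine Measure.eqOn_open_of_ae_eq hfae hΩ ?_ continuousOn_const
    exact ((hc₁.const_mul _).sub (hc₂.const_mul _)).mono subset_closure
  have hrange : range (Ω.indicator y) ⊆
      {η | n * p * Φ η = (n - p) * fderiv ℝ Φ η η} := by
    rintro _ ⟨x, rfl⟩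
    by_cases hx : x ∈ Ω
    · rw [indicator_of_mem hx]
      have : f x = 0 := hfΩ hx
      simp only [f] at this
      simp only [mem_ofPred_eq]
      linarith
    · rw [indicator_of_notMem hx]
      simp [hΦ0]
  -- A point outside `Ω` puts `0` in the range of the extension, so the component in question is the
  -- one containing `0`.
  obtain ⟨z, hz⟩ : ∃ z, z ∉ Ω := by
    by_contra! hall
    exact NormedSpace.unbounded_univ ℝ E (hb.subset fun x _ => hall x)
  have hconn := (isPreconnected_range hYc).subset_connectedComponentIn
    ⟨z, indicator_of_notMem hz y⟩ hrange
  rw [hZ] at hconn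
  intro x hx
  by_cases hxΩ : x ∈ Ω
  · have : Ω.indicator y x = 0 := hconn (mem_range_self x)
    rwa [indicator_of_mem hxΩ] at this
  · exact hy0 x ⟨hx, by rwa [hΩ.interior_eq]⟩

theorem eq_zero_of_weakForm_of_starConvex [Nontrivial E] {w : (E →L[ℝ] F) → ℝ}
    (hw : ContDiff ℝ 1 w) {p : ℝ} (hp : 1 ≤ p)
    (hhom : ∀ t : ℝ, 0 < t → ∀ A, w (t • A) = t ^ p * w A)
    (hrank : ∀ A : E →L[ℝ] F, finrank ℝ (LinearMap.range (A : E →ₗ[ℝ] F)) ≤ 1 → 0 ≤ w A)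
    {Ω : Set E} (hΩ : IsOpen Ω) (hb : Bornology.IsBounded Ω) {a : E} (hstar : StarConvex ℝ a Ω)
    {Φ : F → ℝ} (hΦ : ContDiff ℝ 1 Φ) (hΦ0 : Φ 0 = 0)
    (hle : ∀ η, (finrank ℝ E : ℝ) * p * Φ η ≤ (finrank ℝ E - p) * fderiv ℝ Φ η η)
    (hZ : connectedComponentIn
      {η | (finrank ℝ E : ℝ) * p * Φ η = (finrank ℝ E - p) * fderiv ℝ Φ η η} 0 = {0})
    {y : E → F} (hy : ContDiffOn ℝ 2 y (closure Ω)) (hy0 : ∀ x ∈ frontier Ω, y x = 0)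
    (h : WeakForm μ Ω (fun x => fderiv ℝ w (fderiv ℝ y x)) (fun x => fderiv ℝ Φ (y x))) :
    ∀ x ∈ closure Ω, y x = 0 := by
  let e : E ≃ₜ E := Homeomorph.addLeft a
  have hcl : closure (e ⁻¹' Ω) = e ⁻¹' closure Ω := (e.preimage_closure Ω).symm
  have hfr : frontier (e ⁻¹' Ω) = e ⁻¹' frontier Ω := (e.preimage_frontier Ω).symm
  have hb' : Bornology.IsBounded (e ⁻¹' Ω) := by
    have : e ⁻¹' Ω = (fun x => -a + x) '' Ω := by
      ext x
      refine ⟨fun hx => ⟨a + x, hx, by simp⟩, ?_⟩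
      rintro ⟨z, hz, rfl⟩
      simpa [e] using hz
    rw [this]
    exact (LipschitzWith.of_dist_le_mul (K := 1) fun x z => by simp).isBounded_image hb
  have key := eq_zero_of_weakForm (μ := μ) (Ω := e ⁻¹' Ω) (y := fun x => y (a + x)) hw hp hhom hrank
    (hΩ.preimage e.continuous) hb' (StarConvex.preimage_add_right (by simpa using hstar))
    hΦ hΦ0 hle hZ
    (by
      rw [hcl]
      exact hy.comp (contDiff_const.add contDiff_id).contDiffOn fun x hx => hx)
    (by
      rw [hfr]
      exact fun x hx => hy0 _ hx)
    (by
      simp only [fderiv_comp_add_left]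
      exact h.translate a)
  intro x hx
  have h1 := key (-a + x) (by
    rw [hcl]
    simpa [e] using hx)
  simpa using h1

end Uniqueness

/-! ### Matrices, rank-one maps and the distributional equation -/

section Matrix

variable {m n : ℕ}

/-- The matrix of a linear map between Euclidean spaces. -/
noncomputable def matrixOf (m n : ℕ) :
    (EuclideanSpace ℝ (Fin n) →L[ℝ] EuclideanSpace ℝ (Fin m)) →L[ℝ] Matrix (Fin m) (Fin n) ℝ :=
  LinearMap.toContinuousLinearMap
    { toFun := fun A => Matrix.of fun i j => A (EuclideanSpace.single j 1) i
      map_add' := fun _ _ => rfl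
      map_smul' := fun _ _ => rfl }

theorem matrixOf_apply (A : EuclideanSpace ℝ (Fin n) →L[ℝ] EuclideanSpace ℝ (Fin m)) (i : Fin m)
    (j : Fin n) : matrixOf m n A i j = A (EuclideanSpace.single j 1) i := rfl

theorem matrixOf_fderiv (y : EuclideanSpace ℝ (Fin n) → EuclideanSpace ℝ (Fin m))
    (x : EuclideanSpace ℝ (Fin n)) : matrixOf m n (fderiv ℝ y x) = jacobian y x := rfl

theorem fderiv_apply_eq_sum_matrixGradient (W : Matrix (Fin m) (Fin n) ℝ → ℝ)
    (A B : Matrix (Fin m) (Fin n) ℝ) :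
    fderiv ℝ W A B = ∑ i, ∑ j, matrixGradient W A i j * B i j := by
  conv_lhs => rw [Matrix.matrix_eq_sum_single B]
  simp only [map_sum]
  refine Finset.sum_congr rfl fun i _ => Finset.sum_congr rfl fun j _ => ?_
  have : Matrix.single i j (B i j) = B i j • Matrix.single i j (1 : ℝ) := by
    rw [Matrix.smul_single, smul_eq_mul, mul_one]
  rw [this, map_smul, smul_eq_mul, mul_comm]
  rfl

theorem fderiv_comp_matrixOf {W : Matrix (Fin m) (Fin n) ℝ → ℝ} (hW : ContDiff ℝ 1 W)
    (A B : EuclideanSpace ℝ (Fin n) →L[ℝ] EuclideanSpace ℝ (Fin m)) :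
    fderiv ℝ (fun A => W (matrixOf m n A)) A B =
      fderiv ℝ W (matrixOf m n A) (matrixOf m n B) := by
  have h := ((hW.differentiable (by simp) (matrixOf m n A)).hasFDerivAt.comp A
    (matrixOf m n).hasFDerivAt).fderiv
  exact congrArg (fun L => L B) h

/-- All columns are multiples of one vector spanning the range; the multiples form `ν`. -/
theorem exists_matrixOf_eq_vecMulVec
    {A : EuclideanSpace ℝ (Fin n) →L[ℝ] EuclideanSpace ℝ (Fin m)}
    (hA : finrank ℝ (LinearMap.range (A : EuclideanSpace ℝ (Fin n) →ₗ[ℝ]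
      EuclideanSpace ℝ (Fin m))) ≤ 1) :
    ∃ (a : Fin m → ℝ) (ν : Fin n → ℝ), matrixOf m n A = Matrix.vecMulVec a ν := by
  obtain ⟨v, hv⟩ := finrank_le_one_iff.1 hA
  choose c hc using fun j : Fin n => hv ⟨A (EuclideanSpace.single j 1), ⟨_, rfl⟩⟩
  refine ⟨fun i => (v : EuclideanSpace ℝ (Fin m)) i, c, ?_⟩
  ext i j
  have h1 : c j • (v : EuclideanSpace ℝ (Fin m)) = A (EuclideanSpace.single j 1) :=
    congrArg Subtype.val (hc j)
  rw [matrixOf_apply, ← h1, Matrix.vecMulVec_apply, PiLp.smul_apply, smul_eq_mul, mul_comm]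

theorem fderiv_apply_eq_inner_gradient (Φ : EuclideanSpace ℝ (Fin m) → ℝ)
    (η v : EuclideanSpace ℝ (Fin m)) : fderiv ℝ Φ η v = inner ℝ (gradient Φ η) v := by
  rw [gradient, InnerProductSpace.toDual_symm_apply]

theorem continuous_matrixGradient {W : Matrix (Fin m) (Fin n) ℝ → ℝ} (hW : ContDiff ℝ 1 W) :
    Continuous (matrixGradient W) :=
  continuous_pi fun i => continuous_pi fun j =>
    (hW.continuous_fderiv (by simp)).clm_apply continuous_const

theorem integrable_of_continuousOn_of_support_subset {X : Type*} [TopologicalSpace X]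
    [MeasurableSpace X] [OpensMeasurableSpace X] [T2Space X] {ν : Measure X}
    [IsFiniteMeasureOnCompacts ν] {K : Set X} (hK : IsCompact K) {f : X → ℝ}
    (hf : ContinuousOn f K) (hs : Function.support f ⊆ K) : Integrable f ν :=
  (integrableOn_iff_integrable_of_support_subset hs).1 (hf.integrableOn_compact hK)

/-- The scalar equations are tested with the components of `φ` and summed; compact support in `Ω`
provides the integrability for splitting the sums. -/
theorem IsSolution.weakForm {W : Matrix (Fin m) (Fin n) ℝ → ℝ} (hW : ContDiff ℝ 1 W)
    {Φ : EuclideanSpace ℝ (Fin m) → ℝ} (hΦ : ContDiff ℝ 1 Φ)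
    {Ω : Set (EuclideanSpace ℝ (Fin n))} (hΩ : IsOpen Ω)
    {y : EuclideanSpace ℝ (Fin n) → EuclideanSpace ℝ (Fin m)} (h : IsSolution W Φ Ω y) :
    WeakForm volume Ω (fun x => fderiv ℝ (fun A => W (matrixOf m n A)) (fderiv ℝ y x))
      (fun x => fderiv ℝ Φ (y x)) := by
  intro φ hφ hc hs
  have hyΩ : ContDiffOn ℝ 2 y Ω := h.contDiffOn.mono subset_closure
  have hDy : ContinuousOn (fderiv ℝ y) Ω := hyΩ.continuousOn_fderiv_of_isOpen hΩ (by norm_num)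
  have hφi : ∀ i, ContDiff ℝ ∞ fun x => φ x i := fun i => (contDiff_euclidean.1 hφ) i
  have hsub : ∀ i, (Function.support fun x => φ x i) ⊆ Function.support φ := by
    intro i x hx hx0
    exact hx (by simp [hx0])
  have hts : ∀ i, tsupport (fun x => φ x i) ⊆ tsupport φ := fun i => closure_mono (hsub i)
  have hci : ∀ i, HasCompactSupport fun x => φ x i := fun i => hc.mono (hsub i)
  have hfd : ∀ i x v, fderiv ℝ (fun x => φ x i) x v = fderiv ℝ φ x v i := by
    intro i x v
    have h1 := ((EuclideanSpace.proj (𝕜 := ℝ) i).hasFDerivAt (x := φ x)).comp x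
      (hφ.differentiable (by simp) x).hasFDerivAt
    exact congrArg (fun L => L v) h1.fderiv
  have hVc : ∀ i j, ContinuousOn (fun x => matrixGradient W (jacobian y x) i j) Ω := fun i j =>
    ((continuous_apply_apply i j).comp ((continuous_matrixGradient hW).comp
      (matrixOf m n).continuous)).comp_continuousOn hDy
  have hgc : ∀ i, ContinuousOn (fun x => gradient Φ (y x) i) Ω := fun i => by
    have h1 : Continuous (gradient Φ) :=
      (InnerProductSpace.toDual ℝ _).symm.continuous.comp (hΦ.continuous_fderiv (by simp))
    exact ((EuclideanSpace.proj (𝕜 := ℝ) i).continuous.comp h1).comp_continuousOn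
      hyΩ.continuousOn
  have hi₁ : ∀ i, Integrable (fun x => ∑ j, matrixGradient W (jacobian y x) i j *
      fderiv ℝ (fun x => φ x i) x (EuclideanSpace.single j 1)) volume := by
    refine fun i => integrable_finsetSum _ fun j _ => ?_
    refine integrable_of_continuousOn_of_support_subset hc.isCompact
      (((hVc i j).mono hs).mul
        (((hφi i).continuous_fderiv (by simp)).clm_apply continuous_const).continuousOn) ?_
    intro x hx
    by_contra hx'
    refine hx ?_
    simp only [fderiv_of_notMem_tsupport ℝ fun h => hx' (hts i h)]
    simp
  have hi₂ : ∀ i, Integrable (fun x => gradient Φ (y x) i * φ x i) volume := by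
    refine fun i => integrable_of_continuousOn_of_support_subset hc.isCompact
      (((hgc i).mono hs).mul (hφi i).continuous.continuousOn) ?_
    intro x hx
    by_contra hx'
    exact hx (by simp [image_eq_zero_of_notMem_tsupport hx'])
  have e₁ : ∀ x, fderiv ℝ (fun A => W (matrixOf m n A)) (fderiv ℝ y x) (fderiv ℝ φ x) =
      ∑ i, ∑ j, matrixGradient W (jacobian y x) i j *
        fderiv ℝ (fun x => φ x i) x (EuclideanSpace.single j 1) := by
    intro x
    rw [fderiv_comp_matrixOf hW, fderiv_apply_eq_sum_matrixGradient]
    simp only [hfd, matrixOf_apply, matrixOf_fderiv]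
  have e₂ : ∀ x, fderiv ℝ Φ (y x) (φ x) = ∑ i, gradient Φ (y x) i * φ x i := by
    intro x
    rw [fderiv_apply_eq_inner_gradient, PiLp.inner_apply]
    simp [mul_comm]
  simp only [e₁, e₂]
  rw [integral_finsetSum _ fun i _ => (hi₁ i).integrableOn,
    integral_finsetSum _ fun i _ => (hi₂ i).integrableOn]
  refine Finset.sum_congr rfl fun i _ => ?_
  have := (h.equation i).2.2 (fun x => φ x i) (hφi i) (hci i) ((hts i).trans hs)
  simpa [integral_neg] using this

/-- Derivatives of compactly supported functions integrate to zero. For the zero solution this makes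
the value of `W_F(0)` irrelevant. -/
theorem hasDistribDivergence_const {Ω : Set (EuclideanSpace ℝ (Fin n))} (hΩ : IsOpen Ω)
    (c : Fin n → ℝ) {V : EuclideanSpace ℝ (Fin n) → Fin n → ℝ}
    {f : EuclideanSpace ℝ (Fin n) → ℝ} (hV : ∀ x ∈ Ω, V x = c) (hf : ∀ x ∈ Ω, f x = 0) :
    HasDistribDivergence Ω V f := by
  refine ⟨?_, ?_, fun φ hφ hc hs => ?_⟩
  · exact ((continuousOn_const (c := c)).congr hV).locallyIntegrableOn hΩ.measurableSet
  · exact ((continuousOn_const (c := (0 : ℝ))).congr hf).locallyIntegrableOn hΩ.measurableSet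
  have hcont : ∀ v, Continuous fun x => fderiv ℝ φ x v := fun v =>
    (hφ.continuous_fderiv (by simp)).clm_apply continuous_const
  have hint : ∀ v, Integrable (fun x => fderiv ℝ φ x v) volume := fun v =>
    (hcont v).integrable_of_hasCompactSupport (hc.fderiv_apply ℝ v)
  have hzero : ∀ v, ∫ x, fderiv ℝ φ x v = 0 := by
    intro v
    have h := integral_mul_fderiv_eq_neg_fderiv_mul_of_integrable (μ := volume) (v := v)
      (f := fun _ : EuclideanSpace ℝ (Fin n) => (1 : ℝ)) (g := φ) (by simp)
      (by simpa using hint v)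
      (by simpa using hφ.continuous.integrable_of_hasCompactSupport hc)
      (fun x _ => differentiableAt_const _) (fun x _ => hφ.differentiable (by simp) x)
    simpa using h
  have h2 : ∫ x in Ω, f x * φ x = 0 := by
    refine setIntegral_eq_zero_of_forall_eq_zero fun x hx => ?_
    rw [hf x hx, zero_mul]
  rw [h2, neg_zero, setIntegral_congr_fun (g := fun x => ∑ j, c j *
    fderiv ℝ φ x (EuclideanSpace.single j 1)) hΩ.measurableSet fun x hx => by simp only [hV x hx],
    setIntegral_eq_integral_of_forall_compl_eq_zero, integral_finsetSum]
  · simp [integral_const_mul, hzero]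
  · exact fun j _ => (hint _).const_mul _
  · intro x hx
    simp [fderiv_of_notMem_tsupport ℝ fun h => hx (hs h)]

theorem isSolution_of_eq_zero {W : Matrix (Fin m) (Fin n) ℝ → ℝ}
    {Φ : EuclideanSpace ℝ (Fin m) → ℝ} (hΦ0 : fderiv ℝ Φ 0 = 0)
    {Ω : Set (EuclideanSpace ℝ (Fin n))} (hΩ : IsOpen Ω)
    {y : EuclideanSpace ℝ (Fin n) → EuclideanSpace ℝ (Fin m)} (hy : ∀ x ∈ closure Ω, y x = 0) :
    IsSolution W Φ Ω y where
  contDiffOn := contDiffOn_const.congr hy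
  boundary x hx := hy x (frontier_subset_closure hx)
  equation i := by
    refine hasDistribDivergence_const hΩ (matrixGradient W 0 i) (fun x hx => ?_) fun x hx => ?_
    · have h1 : y =ᶠ[𝓝 x] fun _ => 0 := by
        filter_upwards [hΩ.mem_nhds hx] with z hz
        exact hy z (subset_closure hz)
      have h2 : jacobian y x = 0 := by
        rw [← matrixOf_fderiv, h1.fderiv_eq, fderiv_fun_const, Pi.zero_apply, map_zero]
      rw [h2]
    · rw [hy x (subset_closure hx), gradient, hΦ0]
      simp

end Matrix

end Pohozaev

theorem mainTheorem9 (m n : ℕ) (hn : 0 < n) (p : ℝ) (hp : 1 ≤ p)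
    (W : Matrix (Fin m) (Fin n) ℝ → ℝ) (hW : ContDiff ℝ 1 W)
    (hWhom : ∀ t : ℝ, 0 < t → ∀ F, W (t • F) = t ^ p * W F)
    (hWrankOne : ∀ (a : Fin m → ℝ) (ν : Fin n → ℝ), 0 ≤ W (Matrix.vecMulVec a ν))
    (Ω : Set (EuclideanSpace ℝ (Fin n))) (hΩopen : IsOpen Ω) (hΩbdd : Bornology.IsBounded Ω)
    (x₀ : EuclideanSpace ℝ (Fin n)) (hΩstar : StarConvex ℝ x₀ Ω)
    (Φ : EuclideanSpace ℝ (Fin m) → ℝ) (hΦ : ContDiff ℝ 1 Φ) (hΦ0 : Φ 0 = 0)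
    (hΦle : ∀ η, (n : ℝ) * p * Φ η ≤ ((n : ℝ) - p) * inner ℝ (gradient Φ η) η)
    (hZ : connectedComponentIn
      {η | (n : ℝ) * p * Φ η = ((n : ℝ) - p) * inner ℝ (gradient Φ η) η} 0 = {0}) :
    ∀ y : EuclideanSpace ℝ (Fin n) → EuclideanSpace ℝ (Fin m),
      Pohozaev.IsSolution W Φ Ω y ↔ ∀ x ∈ closure Ω, y x = 0 := by
  intro y
  have hn1 : (1 : ℝ) ≤ n := by exact_mod_cast hn
  have hfin : Module.finrank ℝ (EuclideanSpace ℝ (Fin n)) = n := finrank_euclideanSpace_fin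
  have : Nontrivial (EuclideanSpace ℝ (Fin n)) :=
    Module.nontrivial_of_finrank_pos (R := ℝ) (by rw [hfin]; exact hn)
  simp only [← Pohozaev.fderiv_apply_eq_inner_gradient] at hΦle hZ
  refine ⟨fun h => ?_, fun h => ?_⟩
  · refine Pohozaev.eq_zero_of_weakForm_of_starConvex (μ := volume)
      (w := fun A => W (Pohozaev.matrixOf m n A)) (hW.comp (Pohozaev.matrixOf m n).contDiff) hp
      (fun t ht A => by simp only [map_smul, hWhom t ht]) (fun A hA => ?_) hΩopen hΩbdd hΩstar hΦ
      hΦ0 (by simpa only [hfin] using hΦle) (by simpa only [hfin] using hZ) h.contDiffOn h.boundary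
      (h.weakForm hW hΦ hΩopen)
    obtain ⟨a, ν, ha⟩ := Pohozaev.exists_matrixOf_eq_vecMulVec hA
    rw [ha]
    exact hWrankOne a ν
  · refine Pohozaev.isSolution_of_eq_zero ?_ hΩopen h
    refine Pohozaev.fderiv_zero_eq_zero_of_forall_le hΦ hΦ0 ?_ hΦle
    -- The required `n - p < np` holds because `n - p < n ≤ np`.
    nlinarith
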